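/- **Setting.** Let $k$ be an algebraically closed field. A *prestable curve* $X/k$ is a connected proper $k$-scheme of pure dimension one whose only singularities are finitely many nodes. Its *dual graph* $(V,E)$ has as vertices the irreducible components and as edges the nodes; the ends of a node are the components on its two branches (loops and parallel edges may occur). A *cut* is a set $c\subseteq E$ such that removing $c$ leaves exactly two connected components and every edge of $c$ joins these two. A set of edges is *circuit-connected* if any two distinct edges in it lie on a common circuit (a closed path that repeats no edge and no vertex); a *circuit-connected component* is a maximal nonempty circuit-connected set of edges. A *log structure* on $\operatorname{Spec}k$ is a commutative monoid $M$ with a monoid map $\alpha\colon M\to k$ that restricts to an isomorphism $\alpha^{-1}(k^\times)\to k^\times$; its *characteristic monoid* is $\overline M_k=M/k^\times$. All log structures are fine and saturated. A *log curve* $C/\operatorname{Spec}k$ with underlying curve $X$ is given by such a log structure $M$ on $\operatorname{Spec} k$ together with a map of log structures $\mathbb N^E\oplus k^\times\to M$ from the minimal log structure of $X$ (where $(n,a)\in \mathbb N^E\oplus k^\times$ is sent to $a\in k$ if $n=0$ and to $0$ otherwise). The image of $e\in E$ in $\overline M_k$ is its *length* $\ell(e)$; $\overline M_k$ is ordered by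 $a\le b\iff b\in a+\overline M_k$. The log curve is *weakly $1$-rich* if every cut contains an edge whose length is smallest among the lengths of all edges of the cut. A morphism $w\to z$ of log curves over the identity of the underlying schemes is a map of log structures $M_z\to M_w$ compatible with the maps from $\mathbb N^E\oplus k^\times$. A weakly $1$-rich log curve $z$ is *minimal* if for all weakly $1$-rich log curves $w_1,w_2$ and all morphisms $i\colon w_2\to z$, $j\colon w_2\to w_1$ over the identity of the underlying schemes there is a unique such morphism $h\colon w_1\to z$ with $h\circ j=i$. **Statement.** Let $C/\operatorname{Spec}k$ be a minimal weakly $1$-rich log curve over an algebraically closed field. Then the characteristic monoid $\overline M_k$ is a finitely generated free commutative monoid. It is computed as follows. Choose any total order (enumeration) of $E$. There is exactly one function $f$ that sends each cut $c$ to its edge of smallest length, taking the first one in the enumeration if there are several. Let $\le$ be the preorder on $E$ generated by $f(c)\le e$ for all cuts $c$ and all $e\in c$. Let $M_f\subset\mathbb Z^E$ be the submonoid generated by $\mathbb N^E$ and the elements $e-f(c)$ for all cuts $c$ and all $e\in c$. Then: 1. $\le$ is a partial order, and every circuit-connected component has a unique smallest edge for $\le$. Let $E_0$ be the set of these smallest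 edges and $E_1=E\setminus E_0$. 2. For every $e\in E_1$ there is a largest edge $g(e)$ among the edges strictly smaller than $e$. 3. $M_f$ is the free commutative monoid on the $|E|$ elements $e$ (for $e\in E_0$) and $e-g(e)$ (for $e\in E_1$). 4. The map $\mathbb N^E\to M$ extends uniquely to a monoid map $M_f\to M$. The kernel $F$ of the composite $M_f\to M\xrightarrow{\alpha}k\to k/k^\times$ (the set of elements whose image in $k$ is nonzero) is a face of $M_f$, and the induced map $M_f/F\to\overline M_k$ is an isomorphism. In particular, $\overline M_k$ is free on the images of those generators in 3 that do not lie in $F$. -/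

import Mathlib

universe u

open CategoryTheory AlgebraicGeometry

noncomputable section

namespace WeaklyRich

/-! ### Multigraphs: cuts, circuits and circuit-connected components -/

/-- A graph, with loops and parallel edges allowed: `IsLink e x y` says that the two ends of the
edge `e` are the vertices `x` and `y`. -/
structure Multigraph where
  V : Type u
  E : Type u
  IsLink : E → V → V → Prop
  symm : ∀ {e x y}, IsLink e x y → IsLink e y x

namespace Multigraph

variable (G : Multigraph.{u})

/-- The graph with the edges in `c` removed (loops and multiplicities forgotten, as they do not
affect connectedness). -/
def remove (c : Set G.E) : SimpleGraph G.V :=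
  SimpleGraph.fromRel fun x y => ∃ e, e ∉ c ∧ G.IsLink e x y

/-- A cut: a set `c` of edges such that removing `c` leaves exactly two connected components,
and such that every edge of `c` connects these two components. -/
def IsCut (c : Set G.E) : Prop :=
  Nat.card (G.remove c).ConnectedComponent = 2 ∧
    ∀ e ∈ c, ∃ x y, G.IsLink e x y ∧ ¬ (G.remove c).Reachable x y

/-- The set of all cuts. -/
def Cuts : Type u := {c : Set G.E // G.IsCut c}

/-- A circuit: the edges `e₀, …, eₙ₋₁` (`n ≥ 1`) of a closed path that repeats no edge and no
vertex. A loop is a circuit of length `1`, two parallel edges are a circuit of length `2`. -/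
def IsCircuit (s : Set G.E) : Prop :=
  ∃ (n : ℕ) (v : ZMod n → G.V) (e : ZMod n → G.E), n ≠ 0 ∧ Function.Injective v ∧
    Function.Injective e ∧ (∀ i, G.IsLink (e i) (v i) (v (i + 1))) ∧ Set.range e = s

/-- Any two distinct edges of `t` lie on a common circuit. -/
def CircuitConnected (t : Set G.E) : Prop :=
  ∀ e ∈ t, ∀ e' ∈ t, e ≠ e' → ∃ s, G.IsCircuit s ∧ e ∈ s ∧ e' ∈ s

/-- The maximal (nonempty) circuit-connected sets of edges. -/
def IsCircuitComponent (t : Set G.E) : Prop :=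
  Maximal (fun s : Set G.E => s.Nonempty ∧ G.CircuitConnected s) t

variable {G}

/-- The preorder on the edges generated by `f c ≤ e` for all cuts `c` and all `e ∈ c`. -/
def GenLE (f : G.Cuts → G.E) : G.E → G.E → Prop :=
  Relation.ReflTransGen fun a b => ∃ c : G.Cuts, a = f c ∧ b ∈ c.1

/-- `m` is a smallest edge of the set `t`, for the preorder generated by `f`. -/
def IsSmallestIn (f : G.Cuts → G.E) (t : Set G.E) (m : G.E) : Prop :=
  m ∈ t ∧ ∀ e ∈ t, GenLE f m e

/-- The set `E₀` of the smallest edges of the circuit-connected components. -/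
def smallestEdges (f : G.Cuts → G.E) : Set G.E :=
  {m | ∃ t, G.IsCircuitComponent t ∧ IsSmallestIn f t m}

/-- `b` is the largest edge strictly smaller than `e`, for the preorder generated by `f`. -/
def IsLargestBelow (f : G.Cuts → G.E) (e b : G.E) : Prop :=
  (GenLE f b e ∧ ¬ GenLE f e b) ∧ ∀ a, GenLE f a e → ¬ GenLE f e a → GenLE f a b

/-- The basis vector of `ℤ^E` that belongs to an edge. -/
def vec (e : G.E) : G.E →₀ ℤ := Finsupp.single e 1

/-- The submonoid `M_f` of `ℤ^E` generated by `ℕ^E` and all `e - f c` with `e ∈ c`. -/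
def choiceMonoid (f : G.Cuts → G.E) : AddSubmonoid (G.E →₀ ℤ) :=
  AddSubmonoid.closure
    (Set.range vec ∪ {x | ∃ c : G.Cuts, ∃ e ∈ c.1, x = vec e - vec (f c)})

theorem vec_mem (f : G.Cuts → G.E) (e : G.E) : vec e ∈ choiceMonoid f :=
  AddSubmonoid.subset_closure (Or.inl ⟨e, rfl⟩)

end Multigraph

/-! ### Faces and quotients of commutative monoids -/

/-- A face of a commutative monoid. -/
def IsFace {A : Type*} [AddCommMonoid A] (F : AddSubmonoid A) : Prop :=
  ∀ x y, x + y ∈ F → x ∈ F ∧ y ∈ F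

/-- The congruence whose quotient is the quotient monoid `A / F`. -/
def quotientCon {A : Type*} [AddCommMonoid A] (F : AddSubmonoid A) : AddCon A where
  r x y := ∃ a ∈ F, ∃ b ∈ F, x + a = y + b
  iseqv :=
    { refl := fun _ => ⟨0, F.zero_mem, 0, F.zero_mem, rfl⟩
      symm := by
        rintro x y ⟨a, ha, b, hb, h⟩
        exact ⟨b, hb, a, ha, h.symm⟩
      trans := by
        rintro x y z ⟨a, ha, b, hb, h⟩ ⟨a', ha', b', hb', h'⟩
        refine ⟨a + a', F.add_mem ha ha', b' + b, F.add_mem hb' hb, ?_⟩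
        rw [← add_assoc, h, add_right_comm, h', add_assoc] }
  add' := by
    rintro w x y z ⟨a, ha, b, hb, h⟩ ⟨a', ha', b', hb', h'⟩
    refine ⟨a + a', F.add_mem ha ha', b + b', F.add_mem hb hb', ?_⟩
    rw [add_add_add_comm, h, h', add_add_add_comm]

/-! ### Prestable curves over an algebraically closed field and their dual graphs -/

section Curve

variable {k : Type u} [Field k]

/-- The structure map from `k` to a local ring of a `k`-scheme. -/
def toStalk {C : Scheme.{u}} (π : C ⟶ Spec (CommRingCat.of k)) (x : C) :
    k →+* C.presheaf.stalk x :=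
  ((Scheme.ΓSpecIso (CommRingCat.of k)).inv ≫ π.appTop ≫
    C.presheaf.germ ⊤ x trivial).hom

/-- The complete local ring `k⟦x, y⟧ / (x y)`. -/
abbrev NodeRing (k : Type u) [Field k] : Type u :=
  MvPowerSeries (Fin 2) k ⧸
    Ideal.span {(MvPowerSeries.X 0 * MvPowerSeries.X 1 : MvPowerSeries (Fin 2) k)}

/-- A node: a closed point whose completed local ring is isomorphic to `k⟦x, y⟧ / (x y)`
over `k`. -/
def IsNode {C : Scheme.{u}} (π : C ⟶ Spec (CommRingCat.of k)) (x : C) : Prop :=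
  IsClosed {x} ∧
    ∃ φ : AdicCompletion (IsLocalRing.maximalIdeal (C.presheaf.stalk x))
        (C.presheaf.stalk x) ≃+* NodeRing k,
      ∀ a : k, φ (algebraMap (C.presheaf.stalk x) _ (toStalk π x a)) =
        Ideal.Quotient.mk _ (MvPowerSeries.C a)

variable (k) in
/-- A prestable curve over an algebraically closed field `k`: a connected proper `k`-scheme of
pure dimension one whose only singularities are finitely many nodes. Over an algebraically closed
field, the smooth closed points of a curve are those at which the local ring is a discrete
valuation ring. -/
structure PrestableCurve where
  C : Scheme.{u}
  π : C ⟶ Spec (CommRingCat.of k)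
  proper : IsProper π
  connected : ConnectedSpace C
  smooth_or_node : ∀ x : C, IsClosed {x} →
    (∃ _ : IsDomain (C.presheaf.stalk x), IsDiscreteValuationRing (C.presheaf.stalk x)) ∨
      IsNode π x
  finite_nodes : {x : C | IsNode π x}.Finite

/-- The dual graph: vertices are the irreducible components, edges are the nodes, and the ends of
a node are the components through it (a node that lies on only one component is a loop). -/
def PrestableCurve.dualGraph (X : PrestableCurve k) : Multigraph.{u} where
  V := {Z : Set X.C // Z ∈ irreducibleComponents X.C}
  E := {x : X.C // IsNode X.π x}
  IsLink e Z W := ∀ Y : {Z : Set X.C // Z ∈ irreducibleComponents X.C},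
    e.1 ∈ Y.1 ↔ Y = Z ∨ Y = W
  symm h Y := (h Y).trans or_comm

/-! ### Log structures on `Spec k` -/

variable (k) in
/-- A log structure on `Spec k`, with `k` algebraically closed. The étale site of `Spec k` being
trivial, it is a commutative monoid `M` with a homomorphism `α : M → k` which restricts to an
isomorphism from `α⁻¹(kˣ)` to `kˣ`. The monoid is written multiplicatively. -/
structure LogStructure where
  M : Type u
  [commMonoid : CommMonoid M]
  α : M →* k
  units : ∀ a : kˣ, ∃! m : M, α m = a

attribute [instance] LogStructure.commMonoid

/-- The characteristic monoid `M / kˣ`, i.e. `M` modulo its units. -/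
abbrev LogStructure.Char (L : LogStructure k) : Type u := Associates L.M

/-- Fine and saturated: `M` is integral and saturated, and the characteristic monoid is finitely
generated. -/
structure LogStructure.IsFS (L : LogStructure k) : Prop where
  integral : ∀ a b c : L.M, a * b = a * c → b = c
  saturated : ∀ (a b : L.M) (n : ℕ), n ≠ 0 → b ^ n ∣ a ^ n → b ∣ a
  fg : Monoid.FG L.Char

/-- A morphism of log structures on `Spec k`. -/
@[ext] structure LogStructure.Hom (L N : LogStructure k) where
  toHom : L.M →* N.M
  comm : ∀ m, N.α (toHom m) = L.α m

/-! ### Log curves -/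

/-- The log structure `ℕ^E ⊕ kˣ` on `Spec k`, with `(n, a)` mapped to `a` if `n = 0` and to `0`
otherwise. For `E` the set of nodes of a prestable curve this is the minimal (initial) log
structure on the base of that curve. -/
def standardLogStructure (k : Type u) [Field k] (E : Type u) : LogStructure k where
  M := Multiplicative (E →₀ ℕ) × kˣ
  α :=
    { toFun := fun p => by
        classical
        exact if Multiplicative.toAdd p.1 = 0 then (p.2 : k) else 0
      map_one' := by simp
      map_mul' := by
        rintro ⟨n, a⟩ ⟨m, b⟩
        by_cases hn : Multiplicative.toAdd n = 0 <;>
          by_cases hm : Multiplicative.toAdd m = 0 <;> simp [hn, hm] }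
  units := by
    intro a
    refine ⟨(1, a), by simp, ?_⟩
    rintro ⟨n, b⟩ h
    by_cases hn : Multiplicative.toAdd n = 0
    · have hb : b = a := by simpa [hn, Units.ext_iff] using h
      have hn1 : n = 1 := hn
      rw [hb, hn1]
    · simp [hn, eq_comm] at h

/-- A log curve over `Spec k` (`k` algebraically closed) with underlying prestable curve `X`: an fs
log structure on `Spec k` with a morphism of log structures to it from the minimal log structure
`ℕ^E ⊕ kˣ` of `X`. These data determine the log structure on `X`: it is the pullback of the minimal
one. -/
structure LogCurve (X : PrestableCurve k) where
  base : LogStructure k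
  isFS : base.IsFS
  str : LogStructure.Hom (standardLogStructure k X.dualGraph.E) base

namespace LogCurve

variable {X : PrestableCurve k}

/-- The element of the monoid `M` of the base that belongs to a node. -/
def smoothing (z : LogCurve X) (e : X.dualGraph.E) : z.base.M :=
  z.str.toHom ((Multiplicative.ofAdd (Finsupp.single e 1), 1) :
    Multiplicative (X.dualGraph.E →₀ ℕ) × kˣ)

/-- The length of an edge, in the characteristic monoid of the base. -/
def length (z : LogCurve X) (e : X.dualGraph.E) : z.base.Char :=
  Associates.mk (z.smoothing e)

/-- A morphism `w ⟶ z` of log curves lying over the identity of the underlying curves: it goes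
from the log structure of `z` to that of `w`. -/
@[ext] structure Hom (w z : LogCurve X) where
  base : LogStructure.Hom z.base w.base
  comm : ∀ m, base.toHom (z.str.toHom m) = w.str.toHom m

instance : Category (LogCurve X) where
  Hom w z := Hom w z
  id w := ⟨⟨MonoidHom.id _, fun _ => rfl⟩, fun _ => rfl⟩
  comp f g := ⟨⟨f.base.toHom.comp g.base.toHom, fun m => by
      simp [f.base.comm, g.base.comm]⟩, fun m => by simp [f.comm, g.comm]⟩

end LogCurve

/-- A subset `A` of a commutative monoid (written multiplicatively, with the divisibility order)
is weakly `r`-close if for all choices of divisors `lam a` of `r` there is a smallest element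
among the multiples `lam a • a` with `a ∈ A`. -/
def WeaklyClose {M : Type*} [CommMonoid M] (r : ℕ) (A : Set M) : Prop :=
  ∀ lam : M → ℕ, (∀ a ∈ A, lam a ∣ r) → ∃ a ∈ A, ∀ b ∈ A, a ^ lam a ∣ b ^ lam b

namespace LogCurve

variable {X : PrestableCurve k}

/-- A log curve is weakly `r`-rich if for every cut of its dual graph the set of lengths of the
edges in the cut is weakly `r`-close. -/
def IsWeaklyRich (r : ℕ) (z : LogCurve X) : Prop :=
  ∀ c : Set X.dualGraph.E, X.dualGraph.IsCut c → WeaklyClose r (z.length '' c)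

/-- A minimal object of the category of weakly `r`-rich log curves: for all morphisms
`i : w₂ ⟶ z` and `j : w₂ ⟶ w₁` over the identity of the underlying schemes there is a unique
`h : w₁ ⟶ z` with `j ≫ h = i`. -/
def IsMinimalWeaklyRich (r : ℕ) (z : LogCurve X) : Prop :=
  z.IsWeaklyRich r ∧ ∀ w₁ w₂ : LogCurve X, w₁.IsWeaklyRich r → w₂.IsWeaklyRich r →
    ∀ (i : w₂ ⟶ z) (j : w₂ ⟶ w₁), ∃! h : w₁ ⟶ z, j ≫ h = i

/-- `f` sends each cut to its edge of smallest length; among several edges of smallest length it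
takes the first one for the given enumeration of the edges. -/
def IsShortestChoice [LinearOrder X.dualGraph.E] (z : LogCurve X)
    (f : X.dualGraph.Cuts → X.dualGraph.E) : Prop :=
  ∀ c, f c ∈ c.1 ∧ ∀ e ∈ c.1,
    z.length (f c) ∣ z.length e ∧ (z.length e = z.length (f c) → f c ≤ e)

/-- `β : M_f → M` extends the map `ℕ^E → M` given by the log curve. -/
def Extends (z : LogCurve X) {f : X.dualGraph.Cuts → X.dualGraph.E}
    (β : Multiplicative (Multigraph.choiceMonoid f) →* z.base.M) : Prop :=
  ∀ e, β (Multiplicative.ofAdd ⟨Multigraph.vec e, Multigraph.vec_mem f e⟩) = z.smoothing e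

/-- The kernel of the composite `M_f → M → k → k / kˣ`. -/
def kernel (z : LogCurve X) {f : X.dualGraph.Cuts → X.dualGraph.E}
    (β : Multiplicative (Multigraph.choiceMonoid f) →* z.base.M) :
    AddSubmonoid (Multigraph.choiceMonoid f) where
  carrier := {x | z.base.α (β (Multiplicative.ofAdd x)) ≠ 0}
  zero_mem' := by simp
  add_mem' := by
    intro x y hx hy
    simpa using ⟨hx, hy⟩

end LogCurve

end Curve

end WeaklyRich

end

open WeaklyRich WeaklyRich.Multigraph

/-!
Minimal weakly `1`-rich log curves have free characteristic monoids.

*Combinatorics.* The coboundaries of sets of vertices of a multigraph form a binary space of sets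
of edges, and in a connected multigraph the cuts with at least one edge are its minimal nonempty
elements, the bonds. Two bonds that meet contain in their union a bond through any two prescribed
elements (`IsBond.exists_isBond_union`), and two distinct edges lie on a common circuit if and only
if they lie on a common bond (`IsBond.exists_isCircuit`, `IsCircuit.exists_isBond`). If `f` chooses
an edge in each cut such that the generated preorder is antisymmetric, then the choice in the third
bond is the choice in one of the first two. It follows that the generating relation is transitive
(`IsOrderlyChoice.genLE_iff`), that the edges below a given edge form a chain, and that each
circuit-connected component has a smallest edge; so the order is a forest. The elements `e` for the
roots and `e - g e` for the other edges generate the choice monoid by telescoping, and they are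
independent because the linear map that sends an edge to the sum of all edges below it sends them
to the standard basis (`IsOrderlyChoice.exists_basis`).

*Geometry.* The complete local ring of a node has two minimal primes, and the minimal primes of a
Noetherian local ring are contracted from its completion, so at most two irreducible components
pass through a node. Distinct components can only meet at nodes; as the curve is connected, so is
its dual graph (`PrestableCurve.isConnected_dualGraph`).

*Log structures.* Divisibility of lengths and cancellation extend `ℕ^E → M` uniquely to `β` on the
choice monoid. The submonoid of elements that `β` maps to units is a face, spanned by some of the
basis vectors; let `J` be the set of the other ones. The log structure `ℕ^J ⊕ kˣ` underlies a weakly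
`1`-rich log curve `w` with a morphism from the given one, and minimality, applied to this
morphism and the identity, provides a morphism back, which is an inverse
(`LogCurve.IsMinimalWeaklyRich.exists_mulEquiv`). Hence the characteristic monoid is `ℕ^J`.
-/

/-! ### Bonds and circuits -/

namespace WeaklyRich.Multigraph

variable {G : Multigraph.{u}}

/-- Every edge has at most one unordered pair of ends. -/
def UniqueEnds (G : Multigraph.{u}) : Prop :=
  ∀ ⦃e x y x' y'⦄, G.IsLink e x y → G.IsLink e x' y' → (x = x' ∧ y = y') ∨ (x = y' ∧ y = x')

/-- The edges that have one end in `A` and the other end outside. -/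
def coboundary (G : Multigraph.{u}) (A : Set G.V) : Set G.E :=
  {e | ∃ x y, G.IsLink e x y ∧ x ∈ A ∧ y ∉ A}

/-- Connectedness of a multigraph, in the form in which it is used: an edge leaves every nonempty
proper set of vertices. -/
def IsConnected (G : Multigraph.{u}) : Prop :=
  ∀ A : Set G.V, A.Nonempty → Aᶜ.Nonempty → (G.coboundary A).Nonempty

/-- A bond: a minimal nonempty coboundary, i.e. an element of minimal support of the binary
cut space. -/
def IsBond (G : Multigraph.{u}) (c : Set G.E) : Prop :=
  Minimal (fun s => s.Nonempty ∧ ∃ A, s = G.coboundary A) c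

theorem mem_coboundary_iff (hU : G.UniqueEnds) {e : G.E} {x y : G.V} (h : G.IsLink e x y)
    (A : Set G.V) : e ∈ G.coboundary A ↔ ¬ (x ∈ A ↔ y ∈ A) := by
  constructor
  · rintro ⟨x', y', h', hx, hy⟩
    rcases hU h h' with ⟨rfl, rfl⟩ | ⟨rfl, rfl⟩ <;> tauto
  · intro hn
    by_cases hx : x ∈ A
    · exact ⟨x, y, h, hx, fun hy => hn (by tauto)⟩
    · exact ⟨y, x, G.symm h, by tauto, hx⟩

theorem coboundary_symmDiff (hU : G.UniqueEnds) (A B : Set G.V) :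
    G.coboundary (symmDiff A B) = symmDiff (G.coboundary A) (G.coboundary B) := by
  ext e
  by_cases he : ∃ x y, G.IsLink e x y
  · obtain ⟨x, y, h⟩ := he
    simp only [Set.mem_symmDiff, mem_coboundary_iff hU h]
    tauto
  · have hn (D : Set G.V) : e ∉ G.coboundary D := fun ⟨x, y, h, _⟩ => he ⟨x, y, h⟩
    simp [Set.mem_symmDiff, hn]

theorem IsBond.eq_of_subset {c : Set G.E} (hc : G.IsBond c) {A : Set G.V}
    (hne : (G.coboundary A).Nonempty) (h : G.coboundary A ⊆ c) : G.coboundary A = c :=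
  hc.eq_of_le ⟨hne, A, rfl⟩ h

theorem remove_adj {c : Set G.E} {x y : G.V} :
    (G.remove c).Adj x y ↔ x ≠ y ∧ ∃ e, e ∉ c ∧ G.IsLink e x y := by
  rw [remove, SimpleGraph.fromRel_adj]
  refine and_congr_right fun _ => ⟨?_, Or.inl⟩
  rintro (h | ⟨e, he, h⟩)
  exacts [h, ⟨e, he, G.symm h⟩]

theorem reachable_of_isLink {c : Set G.E} {e : G.E} {x y : G.V} (he : e ∉ c)
    (h : G.IsLink e x y) : (G.remove c).Reachable x y := by
  by_cases hxy : x = y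
  · rw [hxy]
  · exact (remove_adj.2 ⟨hxy, e, he, h⟩).reachable

/-- If the edges of `c` are removed, no remaining edge leaves a connected component. -/
theorem coboundary_reachable_subset (c : Set G.E) (x : G.V) :
    G.coboundary {y | (G.remove c).Reachable x y} ⊆ c := by
  rintro e ⟨y, z, h, hy, hz⟩
  by_contra he
  exact hz (hy.trans (reachable_of_isLink he h))

/-- A set of vertices whose coboundary lies in `c` is a union of connected components of the graph
without `c`. -/
theorem mem_iff_of_reachable (hU : G.UniqueEnds) {c : Set G.E} {A : Set G.V}
    (hA : G.coboundary A ⊆ c) {x y : G.V} (h : (G.remove c).Reachable x y) :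
    x ∈ A ↔ y ∈ A := by
  obtain ⟨p⟩ := h
  induction p with
  | nil => rfl
  | cons hadj _ ih =>
    obtain ⟨-, e, he, hl⟩ := remove_adj.1 hadj
    refine Iff.trans ?_ ih
    by_contra hn
    exact he (hA ((mem_coboundary_iff hU hl A).2 hn))

/-- A nonempty cut is the coboundary of either of its two sides, and it is minimal because a
coboundary inside it comes from a union of sides. The empty set is a cut of a graph with two
connected components, but not a bond. -/
theorem IsCut.isBond (hU : G.UniqueEnds) {c : Set G.E} (hc : G.IsCut c) (hne : c.Nonempty) :
    G.IsBond c := by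
  obtain ⟨hcard, hlink⟩ := hc
  obtain ⟨e₀, he₀⟩ := hne
  obtain ⟨x, y, -, hxy⟩ := hlink e₀ he₀
  have hcover : ∀ v, (G.remove c).Reachable x v ∨ (G.remove c).Reachable y v := by
    intro v
    by_contra! hv
    have : Finite (G.remove c).ConnectedComponent :=
      Nat.finite_of_card_ne_zero (by rw [hcard]; norm_num)
    have h3 : 3 ≤ Nat.card (G.remove c).ConnectedComponent := by
      have hinj : Function.Injective ![(G.remove c).connectedComponentMk x,
          (G.remove c).connectedComponentMk y, (G.remove c).connectedComponentMk v] := by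
        intro i j hij
        fin_cases i <;> fin_cases j <;>
          simp [SimpleGraph.ConnectedComponent.eq] at hij ⊢ <;>
          first
          | exact hxy hij | exact hxy hij.symm | exact hv.1 hij | exact hv.1 hij.symm
          | exact hv.2 hij | exact hv.2 hij.symm
      simpa using Nat.card_le_card_of_injective _ hinj
    omega
  -- The cut is the coboundary of the component of `x`.
  have hcx : c = G.coboundary {v | (G.remove c).Reachable x v} := by
    refine Set.Subset.antisymm (fun e he => ?_) (coboundary_reachable_subset c x)
    obtain ⟨v, w, hvw, hn⟩ := hlink e he
    rw [mem_coboundary_iff hU hvw]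
    intro hiff
    rcases hcover v with hv | hv
    · exact hn (hv.symm.trans (hiff.1 hv))
    · rcases hcover w with hw | hw
      · exact hn ((hiff.2 hw).symm.trans hw)
      · exact hn (hv.symm.trans hw)
  refine ⟨⟨⟨e₀, he₀⟩, _, hcx⟩, ?_⟩
  rintro _ ⟨⟨e₁, he₁⟩, A, rfl⟩ hA e he
  have hAc (v w) (h : (G.remove c).Reachable v w) : v ∈ A ↔ w ∈ A := mem_iff_of_reachable hU hA h
  -- `A` separates the two components, because some edge of `c` leaves it.
  have hsep : ¬ (x ∈ A ↔ y ∈ A) := by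
    intro hiff
    obtain ⟨v, w, -, hv, hw⟩ := he₁
    rcases hcover v with h | h <;> rcases hcover w with h' | h' <;>
      have h1 := hAc _ _ h <;> have h2 := hAc _ _ h' <;> tauto
  obtain ⟨v, w, hvw, hn⟩ := hlink e he
  rw [mem_coboundary_iff hU hvw]
  rcases hcover v with h | h <;> rcases hcover w with h' | h'
  · exact absurd (h.symm.trans h') hn
  · have h1 := hAc _ _ h; have h2 := hAc _ _ h'; tauto
  · have h1 := hAc _ _ h; have h2 := hAc _ _ h'; tauto
  · exact absurd (h.symm.trans h') hn

theorem IsBond.isCut (hU : G.UniqueEnds) (hconn : G.IsConnected) {c : Set G.E}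
    (hc : G.IsBond c) : G.IsCut c := by
  obtain ⟨⟨e₀, he₀⟩, A, hA⟩ := hc.prop
  have hsep : ∀ e ∈ c, ∀ x y, G.IsLink e x y → ¬ (G.remove c).Reachable x y := by
    intro e he x y hxy hr
    rw [hA, mem_coboundary_iff hU hxy] at he
    exact he (mem_iff_of_reachable hU hA.ge hr)
  obtain ⟨x, y, hxy, -⟩ : e₀ ∈ G.coboundary A := hA ▸ he₀
  have hnxy := hsep e₀ he₀ x y hxy
  -- The coboundary of each component is a nonempty subset of `c`, hence all of `c`, so that
  -- each component contains one of the ends of `e₀`.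
  have hcover : ∀ v, (G.remove c).Reachable v x ∨ (G.remove c).Reachable v y := by
    intro v
    by_contra! hv
    have hcob := hc.eq_of_subset (A := {w | (G.remove c).Reachable v w})
      (hconn _ ⟨v, SimpleGraph.Reachable.refl v⟩ ⟨x, hv.1⟩) (coboundary_reachable_subset c v)
    rw [← hcob, mem_coboundary_iff hU hxy] at he₀
    exact he₀ (iff_of_false hv.1 hv.2)
  refine ⟨?_, fun e he => ?_⟩
  · rw [Nat.card_eq_two_iff]
    refine ⟨(G.remove c).connectedComponentMk x, (G.remove c).connectedComponentMk y,
      fun h => hnxy (SimpleGraph.ConnectedComponent.eq.1 h), ?_⟩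
    refine Set.eq_univ_of_forall fun C => ?_
    induction C using SimpleGraph.ConnectedComponent.ind with
    | h v =>
      rcases hcover v with h | h
      · exact Or.inl (SimpleGraph.ConnectedComponent.eq.2 h)
      · exact Or.inr (SimpleGraph.ConnectedComponent.eq.2 h)
  · have he' := he
    rw [hA] at he'
    obtain ⟨v, w, h, -⟩ := he'
    exact ⟨v, w, h, hsep e he v w h⟩

/-- Every coboundary is covered by the bonds contained in it. -/
theorem exists_isBond_subset [Finite G.E] (hU : G.UniqueEnds) {A : Set G.V} {e : G.E}
    (he : e ∈ G.coboundary A) : ∃ c, G.IsBond c ∧ e ∈ c ∧ c ⊆ G.coboundary A := by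
  obtain ⟨c, hcA, hc⟩ := exists_minimal_le_of_wellFoundedLT
    (fun s : Set G.E => e ∈ s ∧ ∃ B, s = G.coboundary B) _ ⟨he, A, rfl⟩
  obtain ⟨hec, B, rfl⟩ := hc.prop
  refine ⟨_, ⟨⟨⟨e, hec⟩, B, rfl⟩, ?_⟩, hec, hcA⟩
  rintro _ ⟨⟨e', he'⟩, D, rfl⟩ hDB
  by_cases heD : e ∈ G.coboundary D
  · exact hc.le_of_le ⟨heD, D, rfl⟩ hDB
  · -- Otherwise the symmetric difference is a smaller coboundary through `e`.
    exfalso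
    have h := hc.le_of_le (y := symmDiff (G.coboundary B) (G.coboundary D))
      ⟨Or.inl ⟨hec, heD⟩, _, (coboundary_symmDiff hU B D).symm⟩
      (by rintro x (hx | hx); exacts [hx.1, hDB hx.1])
    rcases h (hDB he') with h | h
    exacts [h.2 he', h.2 (hDB he')]

/-- Two bonds that meet contain, in their union, a bond through any element of the first and any
element of the second. This is the transitivity of connectedness in a binary matroid. -/
theorem IsBond.exists_isBond_union [Finite G.E] (hU : G.UniqueEnds) {a b : G.E} {c₁ c₂ : Set G.E}
    (h₁ : G.IsBond c₁) (h₂ : G.IsBond c₂) (ha : a ∈ c₁) (hb : b ∈ c₂)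
    (hne : (c₁ ∩ c₂).Nonempty) : ∃ c, G.IsBond c ∧ a ∈ c ∧ b ∈ c ∧ c ⊆ c₁ ∪ c₂ := by
  obtain ⟨U, hU'⟩ : ∃ U, U = c₁ ∪ c₂ := ⟨_, rfl⟩
  induction U using WellFoundedLT.induction generalizing c₁ with
  | ind U ih =>
  subst hU'
  by_cases ha₂ : a ∈ c₂
  · exact ⟨c₂, h₂, ha₂, hb, Set.subset_union_right⟩
  by_cases hb₁ : b ∈ c₁
  · exact ⟨c₁, h₁, ha, hb₁, Set.subset_union_left⟩
  obtain ⟨e, he₁, he₂⟩ := hne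
  obtain ⟨A₁, hA₁⟩ := h₁.prop.2
  obtain ⟨A₂, hA₂⟩ := h₂.prop.2
  have hd : G.coboundary (symmDiff A₁ A₂) = symmDiff c₁ c₂ := by
    rw [coboundary_symmDiff hU, hA₁, hA₂]
  obtain ⟨c₃, h₃, ha₃, hsub⟩ := exists_isBond_subset hU (A := symmDiff A₁ A₂) (e := a)
    (by rw [hd]; exact Or.inl ⟨ha, ha₂⟩)
  rw [hd] at hsub
  have hsub' : c₃ ⊆ c₁ ∪ c₂ := fun x hx => (hsub hx).imp And.left And.left
  by_cases hb₃ : b ∈ c₃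
  · exact ⟨c₃, h₃, ha₃, hb₃, hsub'⟩
  have he₃ : e ∉ c₃ := fun h => by
    rcases hsub h with h | h
    exacts [h.2 he₂, h.2 he₁]
  have hne₃ : (c₃ ∩ c₂).Nonempty := by
    by_contra hemp
    have h31 : c₃ ⊆ c₁ := fun x hx =>
      (hsub' hx).resolve_right fun h2 => hemp ⟨x, hx, h2⟩
    exact he₃ (h₁.le_of_le h₃.prop h31 he₁)
  by_cases hlt : c₃ ∪ c₂ < c₁ ∪ c₂
  · obtain ⟨c, hc, h, h', h''⟩ := ih _ hlt h₃ ha₃ hne₃ rfl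
    exact ⟨c, hc, h, h', h''.trans hlt.le⟩
  -- Now `c₃` contains `c₁ \ c₂`, so the coboundary `c₃ ∆ c₁` is contained in the bond `c₂`.
  exfalso
  have heq : c₁ ∪ c₂ ⊆ c₃ ∪ c₂ := by
    by_contra hn
    exact hlt ⟨Set.union_subset hsub' Set.subset_union_right, hn⟩
  obtain ⟨A₃, hA₃⟩ := h₃.prop.2
  have h := h₂.le_of_le (y := symmDiff c₃ c₁)
    ⟨⟨e, Or.inr ⟨he₁, he₃⟩⟩, symmDiff A₃ A₁, by rw [coboundary_symmDiff hU, hA₁, hA₃]⟩ (by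
      rintro x (⟨hx, hx'⟩ | ⟨hx, hx'⟩)
      · exact (hsub' hx).resolve_left hx'
      · exact (heq (Or.inl hx)).resolve_left hx')
  rcases h hb with h | h
  exacts [hb₃ h.1, hb₁ h.1]

/-- A path, together with an edge that closes it and is not on it, is a circuit. -/
theorem exists_isCircuit_of_isPath (hU : G.UniqueEnds) {D : Set G.E} {x y : G.V}
    (p : (G.remove D).Walk x y) (hp : p.IsPath) {a : G.E} (ha : a ∈ D) (hyx : G.IsLink a y x) :
    ∃ s, G.IsCircuit s ∧ a ∈ s ∧ ∀ i < p.length, ∃ e ∈ s, e ∉ D ∧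
      G.IsLink e (p.getVert i) (p.getVert (i + 1)) := by
  classical
  have : Nonempty G.E := ⟨a⟩
  have hadj (i) (hi : i < p.length) := (remove_adj.1 (p.adj_getVert_succ hi)).2
  choose! ε hε hlink using hadj
  have hval (i : ZMod (p.length + 1)) : i.val ≤ p.length := Nat.lt_succ_iff.1 (ZMod.val_lt i)
  have hinj : ∀ i ≤ p.length, ∀ j ≤ p.length, p.getVert i = p.getVert j → i = j :=
    fun i hi j hj h => hp.getVert_injOn hi hj h
  let e (i : ZMod (p.length + 1)) : G.E := if i.val < p.length then ε i.val else a
  have hcast (i) (hi : i < p.length + 1) : ((i : ZMod (p.length + 1))).val = i :=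
    ZMod.val_cast_of_lt hi
  refine ⟨Set.range e, ⟨p.length + 1, fun i => p.getVert i.val, e, by simp, ?_, ?_, ?_, rfl⟩,
    ⟨(p.length : ℕ), ?_⟩, fun i hi => ⟨ε i, ⟨(i : ℕ), ?_⟩, hε i hi, hlink i hi⟩⟩
  · exact fun i j h => ZMod.val_injective _ (hinj _ (hval i) _ (hval j) h)
  · intro i j h
    apply ZMod.val_injective
    simp only [e] at h
    split_ifs at h with hi hj hj
    · have hj' := hlink _ hj
      rw [← h] at hj'
      rcases hU (hlink _ hi) hj' with ⟨h1, -⟩ | ⟨h1, h2⟩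
      · exact hinj _ hi.le _ hj.le h1
      · have h1 := hinj _ hi.le _ hj h1
        have h2 := hinj _ hi _ hj.le h2
        omega
    · exact absurd (h ▸ ha) (hε _ hi)
    · exact absurd (h ▸ ha) (hε _ hj)
    · have := hval i; have := hval j; omega
  · intro i
    simp only [e]
    split_ifs with hi
    · have : (i + 1).val = i.val + 1 := by
        rw [← hcast (i.val + 1) (by omega)]; simp
      rw [this]
      exact hlink _ hi
    · have hi' : i.val = p.length := le_antisymm (hval i) (not_lt.1 hi)
      have : (i + 1).val = 0 := by
        have : i + 1 = 0 := by
          rw [← ZMod.natCast_zmod_val i, hi']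
          exact_mod_cast ZMod.natCast_self (p.length + 1)
        rw [this, ZMod.val_zero]
      rw [this, hi']
      simpa using hyx
  · simp only [e]
    rw [hcast _ (by omega), if_neg (lt_irrefl _)]
  · simp only [e]
    rw [hcast _ (by omega), if_pos hi]

/-- Two edges of a bond lie on a common circuit: one of them, closed up by a path that uses no edge
of the bond except the other one. -/
theorem IsBond.exists_isCircuit (hU : G.UniqueEnds) {c : Set G.E} (hc : G.IsBond c) {a b : G.E}
    (ha : a ∈ c) (hb : b ∈ c) (hab : a ≠ b) : ∃ s, G.IsCircuit s ∧ a ∈ s ∧ b ∈ s := by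
  obtain ⟨A, hA⟩ := hc.prop.2
  obtain ⟨x, y, hxy, hx, hy⟩ : a ∈ G.coboundary A := hA ▸ ha
  have haD : a ∈ c \ {b} := ⟨ha, hab⟩
  -- The bond being minimal, the ends of `a` are still connected if only `b` is kept.
  have hr : (G.remove (c \ {b})).Reachable x y := by
    by_contra hn
    have hsub := coboundary_reachable_subset (c \ {b}) x
    have hmem : a ∈ G.coboundary {z | (G.remove (c \ {b})).Reachable x z} :=
      ⟨x, y, hxy, SimpleGraph.Reachable.refl x, hn⟩
    have heq := hc.eq_of_subset ⟨a, hmem⟩ (hsub.trans Set.sdiff_subset)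
    exact (hsub (heq.ge hb)).2 rfl
  obtain ⟨p, hp⟩ := hr.exists_isPath
  obtain ⟨s, hs, has, hedge⟩ := exists_isCircuit_of_isPath hU p hp haD (G.symm hxy)
  refine ⟨s, hs, has, ?_⟩
  -- The path has to leave `A`, and the only edge that it can use is `b`.
  obtain ⟨i, hi, hiA, hiA'⟩ : ∃ i < p.length, p.getVert i ∈ A ∧ p.getVert (i + 1) ∉ A := by
    by_contra! hn
    have hall : ∀ i ≤ p.length, p.getVert i ∈ A := by
      intro i
      induction i with
      | zero => intro _; simpa using hx
      | succ i ih => exact fun h => hn i h (ih (Nat.le_of_succ_le h))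
    exact hy (by simpa using hall _ le_rfl)
  obtain ⟨e, hes, heD, hl⟩ := hedge i hi
  have hec : e ∈ c := hA ▸ ⟨_, _, hl, hiA, hiA'⟩
  have : e = b := by_contra fun h => heD ⟨hec, h⟩
  exact this ▸ hes

/-- The vertices on the arc of a circuit between two of its edges have a coboundary that meets the
circuit in these two edges; a bond inside it through one of them contains the other as well. -/
theorem IsCircuit.exists_isBond [Finite G.E] (hU : G.UniqueEnds) {s : Set G.E}
    (hs : G.IsCircuit s) {a b : G.E} (ha : a ∈ s) (hb : b ∈ s) (hab : a ≠ b) :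
    ∃ c, G.IsBond c ∧ a ∈ c ∧ b ∈ c := by
  obtain ⟨n, v, e, hn, hv, he, hlink, rfl⟩ := hs
  have : NeZero n := ⟨hn⟩
  obtain ⟨i, rfl⟩ := ha
  obtain ⟨j, rfl⟩ := hb
  -- `m + 1` is the number of steps from the edge `i` to the edge `j`.
  obtain ⟨m, hm, hj⟩ : ∃ m, m + 1 < n ∧ j = i + 1 + m := by
    have hne : j - i ≠ 0 := fun h => hab (by rw [sub_eq_zero.1 h])
    have hpos : (j - i).val ≠ 0 := fun h => hne ((ZMod.val_eq_zero _).1 h)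
    have hlt := ZMod.val_lt (j - i)
    refine ⟨(j - i).val - 1, by omega, ?_⟩
    have h : (((j - i).val - 1 : ℕ) : ZMod n) + 1 = j - i := by
      rw [← Nat.cast_succ, Nat.succ_eq_add_one, Nat.sub_add_cancel (by omega),
        ZMod.natCast_zmod_val]
    linear_combination -h
  have hcast {q r : ℕ} (hq : q < n) (hr : r < n) (h : (q : ZMod n) = r) : q = r := by
    have := congrArg ZMod.val h
    rwa [ZMod.val_cast_of_lt hq, ZMod.val_cast_of_lt hr] at this
  -- The arc of vertices between the two edges.
  let A : Set G.V := {x | ∃ q : ℕ, q ≤ m ∧ x = v (i + 1 + q)}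
  have hmemA (q : ℕ) (hq : q < n) : v (i + 1 + q) ∈ A ↔ q ≤ m := by
    refine ⟨?_, fun h => ⟨q, h, rfl⟩⟩
    rintro ⟨r, hr, h⟩
    have := hcast hq (by omega) (add_left_cancel (hv h))
    omega
  have hlast : i + 1 + ((n - 1 : ℕ) : ZMod n) = i := by
    rw [add_assoc, ← Nat.cast_one, ← Nat.cast_add, show 1 + (n - 1) = n by omega,
      ZMod.natCast_self, add_zero]
  have hiA : e i ∈ G.coboundary A := by
    rw [mem_coboundary_iff hU (hlink i)]
    have h1 := hmemA (n - 1) (by omega)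
    rw [hlast] at h1
    have h2 := hmemA 0 (by omega)
    rw [Nat.cast_zero, add_zero] at h2
    rw [h1, h2]
    omega
  obtain ⟨c, hc, hic, hcA⟩ := exists_isBond_subset hU hiA
  refine ⟨c, hc, hic, ?_⟩
  -- The bond meets the circuit at most in the two edges; it cannot meet it in one edge only.
  by_contra hjc
  obtain ⟨B, rfl⟩ := hc.prop.2
  have hstep (q : ℕ) (hq : q + 1 < n) : v (i + 1 + q) ∈ B ↔ v (i + 1 + (q + 1 : ℕ)) ∈ B := by
    by_contra hnB
    have h : e (i + 1 + q) ∈ G.coboundary B := by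
      rw [mem_coboundary_iff hU (hlink _)]
      rwa [Nat.cast_succ, ← add_assoc] at hnB
    have hA := hcA h
    rw [mem_coboundary_iff hU (hlink _), add_assoc (i + 1), ← Nat.cast_succ,
      hmemA q (by omega), hmemA _ (by omega)] at hA
    have : q = m := by omega
    subst this
    exact hjc (hj ▸ h)
  have hall (q : ℕ) (hq : q < n) : v (i + 1) ∈ B ↔ v (i + 1 + q) ∈ B := by
    induction q with
    | zero => simp
    | succ q ih => exact (ih (by omega)).trans (hstep q hq)
  rw [mem_coboundary_iff hU (hlink i)] at hic
  have := hall (n - 1) (by omega)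
  rw [hlast] at this
  tauto

end WeaklyRich.Multigraph

/-! ### The dual graph of a prestable curve -/

namespace WeaklyRich

/-- Setting one variable to zero has the ideal generated by that variable as its kernel. -/
theorem _root_.MvPowerSeries.killCompl_subtype_eq_zero_iff {σ R : Type*} [CommSemiring R] (i : σ)
    (φ : MvPowerSeries σ R) :
    MvPowerSeries.killCompl (Function.Embedding.subtype fun j => j ≠ i) φ = 0 ↔
      MvPowerSeries.X i ∣ φ := by
  classical
  rw [MvPowerSeries.X_dvd_iff]
  constructor
  · intro h m hm
    have hmem : Finsupp.embDomain (Function.Embedding.subtype fun j => j ≠ i)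
        (m.subtypeDomain fun j => j ≠ i) = m := by
      ext j
      by_cases hj : j = i
      · subst hj
        rw [Finsupp.embDomain_of_notMem_range, hm]
        exact fun ⟨l, hl⟩ => l.2 hl
      · exact Finsupp.embDomain_apply_self (Function.Embedding.subtype fun j => j ≠ i) _ ⟨j, hj⟩
    rw [← hmem, ← MvPowerSeries.coeff_killCompl, h, map_zero]
  · intro h
    ext m
    rw [MvPowerSeries.coeff_killCompl, h, map_zero]
    rw [Finsupp.embDomain_of_notMem_range]
    exact fun ⟨l, hl⟩ => l.2 hl

/-- The branch of the node on which the coordinate `i` vanishes, as a map from the local ring of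
the node to the power series ring of the branch. -/
noncomputable def branch (k : Type u) [Field k] (i : Fin 2) :
    NodeRing k →+* MvPowerSeries {j : Fin 2 // j ≠ i} k :=
  Ideal.Quotient.lift _
    (MvPowerSeries.killCompl (Function.Embedding.subtype fun j => j ≠ i) :
      MvPowerSeries (Fin 2) k →ₐ[k] _).toRingHom (by
      intro a ha
      refine (MvPowerSeries.killCompl_subtype_eq_zero_iff i a).2 ?_
      refine Dvd.dvd.trans ?_ (Ideal.mem_span_singleton.1 ha)
      fin_cases i
      exacts [dvd_mul_right _ _, dvd_mul_left _ _])

instance isPrime_ker_branch (k : Type u) [Field k] (i : Fin 2) :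
    (RingHom.ker (branch k i)).IsPrime :=
  have : IsDomain (MvPowerSeries {j : Fin 2 // j ≠ i} k) := NoZeroDivisors.to_isDomain _
  RingHom.ker_isPrime _

theorem ker_branch_le {k : Type u} [Field k] {i : Fin 2} {q : Ideal (NodeRing k)}
    (hq : Ideal.Quotient.mk _ (MvPowerSeries.X i) ∈ q) : RingHom.ker (branch k i) ≤ q := by
  intro a ha
  obtain ⟨φ, rfl⟩ := Ideal.Quotient.mk_surjective a
  obtain ⟨ψ, rfl⟩ := (MvPowerSeries.killCompl_subtype_eq_zero_iff i φ).1 ha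
  rw [map_mul]
  exact q.mul_mem_right _ hq

/-- A subring of `k⟦x, y⟧ / (x y)` has at most two minimal primes, because each of them is
the contraction of `(x)` or of `(y)`. -/
theorem minimalPrimes_subset_of_injective {k R : Type u} [Field k] [CommRing R]
    (ψ : R →+* NodeRing k) (hψ : Function.Injective ψ) {p : Ideal R} (hp : p ∈ minimalPrimes R) :
    p = (RingHom.ker (branch k 0)).comap ψ ∨ p = (RingHom.ker (branch k 1)).comap ψ := by
  obtain ⟨q, hq, rfl⟩ := Ideal.exists_comap_eq_of_mem_minimalPrimes_of_injective hψ p hp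
  have hker (i : Fin 2) (hi : Ideal.Quotient.mk _ (MvPowerSeries.X i) ∈ q) :
      q.comap ψ = (RingHom.ker (branch k i)).comap ψ := by
    have hle := Ideal.comap_mono (f := ψ) (ker_branch_le hi)
    exact le_antisymm (hp.2 ⟨inferInstance, bot_le⟩ hle) hle
  have hmem : Ideal.Quotient.mk _ (MvPowerSeries.X 0) *
      Ideal.Quotient.mk _ (MvPowerSeries.X 1) ∈ q := by
    rw [← map_mul, Ideal.Quotient.eq_zero_iff_mem.2 (Ideal.mem_span_singleton_self _)]
    exact q.zero_mem
  exact (hq.mem_or_mem hmem).imp (hker 0) (hker 1)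

/-- The generic point of an irreducible component through `x` is a minimal prime of the local
ring at `x`. -/
theorem exists_minimalPrimes_closure_eq {C : Scheme.{u}} {x : C} {Z : Set C}
    (hZ : Z ∈ irreducibleComponents C) (hx : x ∈ Z) :
    ∃ p : PrimeSpectrum (C.presheaf.stalk x), p.asIdeal ∈ minimalPrimes (C.presheaf.stalk x) ∧
      closure {C.fromSpecStalk x p} = Z := by
  have hcl : IsClosed Z := isClosed_of_mem_irreducibleComponents Z hZ
  obtain ⟨η, hη⟩ := QuasiSober.sober hZ.1 hcl
  obtain ⟨p, hp⟩ : η ∈ Set.range (C.fromSpecStalk x) := by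
    rw [Scheme.range_fromSpecStalk]
    exact hη.specializes hx
  refine ⟨p, ⟨⟨p.2, bot_le⟩, ?_⟩, by rw [hp]; exact hη⟩
  rintro q ⟨hq, -⟩ hqp
  let q' : PrimeSpectrum (C.presheaf.stalk x) := ⟨q, hq⟩
  have hsp : q' ⤳ p := (PrimeSpectrum.le_iff_specializes q' p).1 hqp
  have hsp' : C.fromSpecStalk x q' ⤳ η := hp ▸ hsp.map (C.fromSpecStalk x).continuous
  -- The closure of the image of `q` is irreducible and contains `Z`, so it is `Z`.
  have hle : Z ⊆ closure {C.fromSpecStalk x q'} := by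
    rw [← hη.def]
    exact closure_minimal (Set.singleton_subset_iff.2 hsp'.mem_closure) isClosed_closure
  have hge := hZ.2 (isIrreducible_singleton.closure) hle
  have hgen : IsGenericPoint (C.fromSpecStalk x q') Z := Set.Subset.antisymm hge hle
  have heq : C.fromSpecStalk x q' = C.fromSpecStalk x p := by rw [hp]; exact hgen.eq hη
  have := (C.fromSpecStalk x).isEmbedding.injective heq
  exact (congrArg PrimeSpectrum.asIdeal this).ge

namespace PrestableCurve

variable {k : Type u} [Field k] (X : PrestableCurve k)

theorem isNoetherian : IsNoetherian X.C := by
  have := X.proper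
  have : IsLocallyNoetherian X.C := LocallyOfFiniteType.isLocallyNoetherian X.π
  have : CompactSpace X.C := QuasiCompact.compactSpace_of_compactSpace X.π
  exact {}

theorem finite_edges : Finite X.dualGraph.E := X.finite_nodes.to_subtype

/-- At most two irreducible components pass through a node. -/
theorem exists_components_of_isNode {x : X.C} (hx : IsNode X.π x) :
    ∃ Z W : Set X.C, ∀ Y ∈ irreducibleComponents X.C, x ∈ Y → Y = Z ∨ Y = W := by
  have := X.isNoetherian
  obtain ⟨-, φ, -⟩ := hx
  let R := X.C.presheaf.stalk x
  let ψ : R →+* NodeRing k := φ.toRingHom.comp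
    (algebraMap R (AdicCompletion (IsLocalRing.maximalIdeal R) R))
  have hψ : Function.Injective ψ :=
    φ.injective.comp (AdicCompletion.of_injective (IsLocalRing.maximalIdeal R) R)
  refine ⟨closure {X.C.fromSpecStalk x ⟨(RingHom.ker (branch k 0)).comap ψ, inferInstance⟩},
    closure {X.C.fromSpecStalk x ⟨(RingHom.ker (branch k 1)).comap ψ, inferInstance⟩}, ?_⟩
  intro Y hY hxY
  obtain ⟨p, hp, rfl⟩ := exists_minimalPrimes_closure_eq hY hxY
  rcases minimalPrimes_subset_of_injective ψ hψ hp with h | h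
  · exact Or.inl (by congr; exact PrimeSpectrum.ext h)
  · exact Or.inr (by congr; exact PrimeSpectrum.ext h)

/-- Two distinct irreducible components that meet at a closed point meet at a node, and there
they are the only components. -/
theorem exists_isLink {x : X.C} (hx : IsClosed {x}) {Z W : X.dualGraph.V} (hZ : x ∈ Z.1)
    (hW : x ∈ W.1) (hne : Z ≠ W) : ∃ e, X.dualGraph.IsLink e Z W := by
  rcases X.smooth_or_node x hx with ⟨hdom, -⟩ | hnode
  · exfalso
    have huniq : ∀ p ∈ minimalPrimes (X.C.presheaf.stalk x), p = ⊥ := by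
      intro p hp
      rwa [IsDomain.minimalPrimes_eq_singleton_bot, Set.mem_singleton_iff] at hp
    obtain ⟨p, hp, hpZ⟩ := exists_minimalPrimes_closure_eq Z.2 hZ
    obtain ⟨q, hq, hqW⟩ := exists_minimalPrimes_closure_eq W.2 hW
    have : p = q := PrimeSpectrum.ext ((huniq _ hp).trans (huniq _ hq).symm)
    exact hne (Subtype.ext (hpZ.symm.trans (this ▸ hqW)))
  · refine ⟨⟨x, hnode⟩, fun Y => ⟨fun hY => ?_, ?_⟩⟩
    · obtain ⟨Z', W', h⟩ := X.exists_components_of_isNode hnode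
      have hne' : Z.1 ≠ W.1 := fun h => hne (Subtype.ext h)
      suffices Y.1 = Z.1 ∨ Y.1 = W.1 from this.imp Subtype.ext Subtype.ext
      rcases h _ Z.2 hZ with h1 | h1 <;> rcases h _ W.2 hW with h2 | h2 <;>
        rcases h _ Y.2 hY with h3 | h3 <;> simp_all
    · rintro (rfl | rfl)
      exacts [hZ, hW]

theorem uniqueEnds_dualGraph : X.dualGraph.UniqueEnds := by
  intro e x y x' y' h h'
  have hiff (Y) : (Y = x ∨ Y = y) ↔ (Y = x' ∨ Y = y') := (h Y).symm.trans (h' Y)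
  have h1 := (hiff x).1 (Or.inl rfl)
  have h2 := (hiff y).1 (Or.inr rfl)
  have h3 := (hiff x').2 (Or.inl rfl)
  have h4 := (hiff y').2 (Or.inr rfl)
  rcases h1 with rfl | rfl <;> rcases h2 with rfl | rfl <;> simp_all

/-- The dual graph is connected: otherwise the curve would be the disjoint union of two closed
unions of irreducible components. -/
theorem isConnected_dualGraph : X.dualGraph.IsConnected := by
  have := X.isNoetherian
  have := X.connected
  have hfin : Finite X.dualGraph.V :=
    (TopologicalSpace.NoetherianSpace.finite_irreducibleComponents (α := X.C)).to_subtype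
  intro A hA hA'
  let S (B : Set X.dualGraph.V) : Set X.C := ⋃ Z ∈ B, Z.1
  have hclosed (B) : IsClosed (S B) :=
    (Set.toFinite B).isClosed_biUnion fun Z _ => isClosed_of_mem_irreducibleComponents _ Z.2
  have hne (B : Set X.dualGraph.V) (hB : B.Nonempty) : (S B).Nonempty := by
    obtain ⟨Z, hZ⟩ := hB
    obtain ⟨x, hx⟩ := Z.2.1.nonempty
    exact ⟨x, Set.mem_biUnion hZ hx⟩
  have hcover : Set.univ ⊆ S A ∪ S Aᶜ := by
    intro x _
    let Z : X.dualGraph.V :=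
      ⟨irreducibleComponent x, irreducibleComponent_mem_irreducibleComponents x⟩
    by_cases hZ : Z ∈ A
    · exact Or.inl (Set.mem_biUnion hZ mem_irreducibleComponent)
    · exact Or.inr (Set.mem_biUnion (show Z ∈ Aᶜ from hZ) mem_irreducibleComponent)
  have hmeet : (S A ∩ S Aᶜ).Nonempty := by
    have := isPreconnected_closed_iff.1 (isPreconnected_univ (α := X.C)) (S A) (S Aᶜ) (hclosed _)
      (hclosed _) hcover (by simpa using hne A hA) (by simpa using hne _ hA')
    simpa using this
  obtain ⟨x, ⟨hxA, hxA'⟩, hx⟩ :=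
    ((hclosed A).inter (hclosed Aᶜ)).exists_closed_singleton hmeet
  simp only [S, Set.mem_iUnion] at hxA hxA'
  obtain ⟨Z, hZA, hxZ⟩ := hxA
  obtain ⟨W, hWA, hxW⟩ := hxA'
  obtain ⟨e, he⟩ := X.exists_isLink hx hxZ hxW (fun h => hWA (h ▸ hZA))
  exact ⟨e, Z, W, he, hZA, hWA⟩

end PrestableCurve

end WeaklyRich

namespace WeaklyRich.Multigraph

variable {G : Multigraph.{u}} {f : G.Cuts → G.E}

theorem GenLE.of_mem (c : G.Cuts) {e : G.E} (he : e ∈ c.1) : GenLE f (f c) e :=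
  Relation.ReflTransGen.single ⟨c, rfl, he⟩

/-- The generators of the choice monoid that form its basis: the smallest edges `e`, and the
differences `e - g e` for the other edges. -/
noncomputable def basisVec (f : G.Cuts → G.E)
    (g : {e // e ∉ smallestEdges f} → G.E) (e : G.E) : G.E →₀ ℤ :=
  open Classical in if h : e ∈ smallestEdges f then vec e else vec e - vec (g ⟨e, h⟩)

theorem basisVec_of_mem {g : {e // e ∉ smallestEdges f} → G.E}
    {e : G.E} (h : e ∈ smallestEdges f) :
    basisVec f g e = vec e := dif_pos h

theorem basisVec_of_notMem {g : {e // e ∉ smallestEdges f} → G.E}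
    {e : G.E} (h : e ∉ smallestEdges f) :
    basisVec f g e = vec e - vec (g ⟨e, h⟩) := dif_neg h

/-- The properties of a multigraph and of a choice of an edge in each cut on which the
combinatorics depends. For the choice of the shortest edges of a weakly rich log curve,
antisymmetry holds because the preorder is contained in the lexicographic combination of the order
of the lengths and the enumeration. -/
structure IsOrderlyChoice (f : G.Cuts → G.E) : Prop where
  uniqueEnds : G.UniqueEnds
  isConnected : G.IsConnected
  mem : ∀ c, f c ∈ c.1
  antisymm : ∀ a b, GenLE f a b → GenLE f b a → a = b

/-! ### The order generated by a choice of edges -/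

namespace IsOrderlyChoice

variable (hf : IsOrderlyChoice f)
include hf

theorem isBond (c : G.Cuts) : G.IsBond c.1 := c.2.isBond hf.uniqueEnds ⟨_, hf.mem c⟩

variable [Finite G.E]

theorem exists_cut_union {c₁ c₂ : G.Cuts} {a b e : G.E} (ha : a ∈ c₁.1) (hb : b ∈ c₂.1)
    (h₁ : e ∈ c₁.1) (h₂ : e ∈ c₂.1) :
    ∃ c : G.Cuts, a ∈ c.1 ∧ b ∈ c.1 ∧ c.1 ⊆ c₁.1 ∪ c₂.1 := by
  obtain ⟨c, hc, h⟩ := (hf.isBond c₁).exists_isBond_union hf.uniqueEnds (hf.isBond c₂) ha hb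
    ⟨e, h₁, h₂⟩
  exact ⟨⟨c, hc.isCut hf.uniqueEnds hf.isConnected⟩, h⟩

/-- The generating relation of the preorder is already transitive. -/
theorem genLE_iff {a b : G.E} : GenLE f a b ↔ a = b ∨ ∃ c : G.Cuts, a = f c ∧ b ∈ c.1 := by
  constructor
  · intro h
    induction h with
    | refl => exact Or.inl rfl
    | @tail b d _ hbd ih =>
      obtain ⟨c', rfl, hd⟩ := hbd
      rcases ih with rfl | ⟨c, rfl, hb⟩
      · exact Or.inr ⟨c', rfl, hd⟩
      obtain ⟨c'', ha, hd', hsub⟩ := hf.exists_cut_union (hf.mem c) hd hb (hf.mem c')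
      refine Or.inr ⟨c'', ?_, hd'⟩
      have hle : GenLE f (f c'') (f c) := .of_mem c'' ha
      refine hf.antisymm _ _ ?_ hle
      rcases hsub (hf.mem c'') with h | h
      · exact GenLE.of_mem c h
      · exact (GenLE.of_mem c hb).trans (GenLE.of_mem c' h)
  · rintro (rfl | ⟨c, rfl, h⟩)
    exacts [.refl, .of_mem c h]

/-- The edges below a given edge form a chain. -/
theorem genLE_total_of_le {a b e : G.E} (ha : GenLE f a e) (hb : GenLE f b e) :
    GenLE f a b ∨ GenLE f b a := by
  rcases hf.genLE_iff.1 ha with rfl | ⟨c, rfl, hc⟩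
  · exact Or.inr hb
  rcases hf.genLE_iff.1 hb with rfl | ⟨c', rfl, hc'⟩
  · exact Or.inl ha
  obtain ⟨c'', h1, h2, hsub⟩ := hf.exists_cut_union (hf.mem c) (hf.mem c') hc hc'
  -- The chosen edge of the third cut is that of `c` or that of `c'`.
  rcases hsub (hf.mem c'') with h | h
  · left
    rw [hf.antisymm _ _ (.of_mem c h) (.of_mem c'' h1)]
    exact .of_mem c'' h2
  · right
    rw [hf.antisymm _ _ (.of_mem c' h) (.of_mem c'' h2)]
    exact .of_mem c'' h1

/-- Circuit-connectedness of two edges is the same as lying on a common cut. -/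
theorem exists_isCircuit_iff {a b : G.E} (hab : a ≠ b) :
    (∃ s, G.IsCircuit s ∧ a ∈ s ∧ b ∈ s) ↔ ∃ c : G.Cuts, a ∈ c.1 ∧ b ∈ c.1 := by
  constructor
  · rintro ⟨s, hs, ha, hb⟩
    obtain ⟨c, hc, h⟩ := hs.exists_isBond hf.uniqueEnds ha hb hab
    exact ⟨⟨c, hc.isCut hf.uniqueEnds hf.isConnected⟩, h⟩
  · rintro ⟨c, ha, hb⟩
    exact (hf.isBond c).exists_isCircuit hf.uniqueEnds ha hb hab

theorem circuitConnected_iff {t : Set G.E} :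
    G.CircuitConnected t ↔ ∀ a ∈ t, ∀ b ∈ t, a ≠ b → ∃ c : G.Cuts, a ∈ c.1 ∧ b ∈ c.1 :=
  forall₄_congr fun _ _ _ _ => forall_congr' fun hab => hf.exists_isCircuit_iff hab

/-- The edges that lie on a common cut with `e` form, together with `e`, a circuit-connected
component. -/
theorem isCircuitComponent_of_edge (e : G.E) :
    G.IsCircuitComponent {a | a = e ∨ ∃ c : G.Cuts, e ∈ c.1 ∧ a ∈ c.1} := by
  refine ⟨⟨⟨e, Or.inl rfl⟩, hf.circuitConnected_iff.2 ?_⟩, ?_⟩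
  · rintro a (rfl | ⟨c, hc, ha⟩) b (rfl | ⟨c', hc', hb⟩) hab
    · exact absurd rfl hab
    · exact ⟨c', hc', hb⟩
    · exact ⟨c, ha, hc⟩
    · obtain ⟨c'', h1, h2, -⟩ := hf.exists_cut_union ha hb hc hc'
      exact ⟨c'', h1, h2⟩
  · rintro s ⟨-, hs⟩ hle a ha
    by_cases hae : a = e
    · exact Or.inl hae
    · exact Or.inr (hf.circuitConnected_iff.1 hs e (hle (Or.inl rfl)) a ha (Ne.symm hae))

theorem isCircuitComponent_eq {t : Set G.E} (ht : G.IsCircuitComponent t) {e : G.E} (he : e ∈ t) :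
    t = {a | a = e ∨ ∃ c : G.Cuts, e ∈ c.1 ∧ a ∈ c.1} := by
  refine ht.eq_of_le (hf.isCircuitComponent_of_edge e).prop fun a ha => ?_
  by_cases hae : a = e
  · exact Or.inl hae
  · exact Or.inr (hf.circuitConnected_iff.1 ht.prop.2 e he a ha (Ne.symm hae))

/-- A circuit-connected component is closed under passing to smaller edges. -/
theorem mem_of_genLE {t : Set G.E} (ht : G.IsCircuitComponent t) {a e : G.E} (he : e ∈ t)
    (h : GenLE f a e) : a ∈ t := by
  rw [hf.isCircuitComponent_eq ht he]
  rcases hf.genLE_iff.1 h with rfl | ⟨c, rfl, hc⟩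
  exacts [Or.inl rfl, Or.inr ⟨c, hc, hf.mem c⟩]

theorem wellFounded : WellFounded fun a b => GenLE f a b ∧ a ≠ b := by
  have : IsTrans G.E fun a b => GenLE f a b ∧ a ≠ b := ⟨fun a b c hab hbc =>
    ⟨hab.1.trans hbc.1, fun hac => hab.2 (hf.antisymm _ _ hab.1 (hac ▸ hbc.1))⟩⟩
  have : Std.Irrefl fun a b : G.E => GenLE f a b ∧ a ≠ b := ⟨fun a h => h.2 rfl⟩
  exact Finite.wellFounded_of_trans_of_irrefl _

theorem existsUnique_isSmallestIn {t : Set G.E} (ht : G.IsCircuitComponent t) :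
    ∃! m, IsSmallestIn f t m := by
  obtain ⟨m, hm, hmin⟩ := hf.wellFounded.has_min t ht.prop.1
  refine ⟨m, ⟨hm, fun e he => ?_⟩, fun m' hm' => ?_⟩
  · rw [hf.isCircuitComponent_eq ht hm] at he
    obtain rfl | ⟨c, hmc, hec⟩ := he
    · exact .refl
    have hle : GenLE f (f c) m := .of_mem c hmc
    have : f c = m := by_contra fun hn => hmin _ (hf.mem_of_genLE ht hm hle) ⟨hle, hn⟩
    exact this ▸ .of_mem c hec
  · exact by_contra fun hn => hmin m' hm'.1 ⟨hm'.2 m hm, hn⟩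

theorem eq_of_genLE_smallestEdges {a m : G.E} (hm : m ∈ smallestEdges f) (h : GenLE f a m) :
    a = m := by
  obtain ⟨t, ht, hmt, hle⟩ := hm
  exact hf.antisymm _ _ h (hle a (hf.mem_of_genLE ht hmt h))

theorem exists_isLargestBelow {e : G.E} (he : e ∉ smallestEdges f) :
    ∃ b, IsLargestBelow f e b := by
  have ht := hf.isCircuitComponent_of_edge e
  obtain ⟨m, hm, -⟩ := hf.existsUnique_isSmallestIn ht
  have hme : GenLE f m e := hm.2 e (Or.inl rfl)
  have hne : m ≠ e := fun h => he ⟨_, ht, h ▸ hm⟩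
  have htrans : IsTrans G.E fun a b => GenLE f b a ∧ b ≠ a := ⟨fun a b c hab hbc =>
    ⟨hbc.1.trans hab.1, fun hac => hab.2 (hf.antisymm _ _ hab.1 (hac ▸ hbc.1))⟩⟩
  have hirr : Std.Irrefl fun a b : G.E => GenLE f b a ∧ b ≠ a := ⟨fun a h => h.2 rfl⟩
  obtain ⟨b, ⟨hbe, hneb⟩, hmax⟩ :=
    (Finite.wellFounded_of_trans_of_irrefl fun a b : G.E => GenLE f b a ∧ b ≠ a).has_min
      {a | GenLE f a e ∧ a ≠ e} ⟨m, hme, hne⟩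
  refine ⟨b, ⟨hbe, fun h => hneb (hf.antisymm _ _ hbe h)⟩, fun a hae hea => ?_⟩
  rcases hf.genLE_total_of_le hae hbe with h | h
  · exact h
  · have : b = a := by_contra fun hn => hmax a ⟨hae, fun h' => hea (h' ▸ .refl)⟩ ⟨h, hn⟩
    exact this ▸ .refl

/-! ### A basis of the choice monoid -/

variable {g : {e // e ∉ smallestEdges f} → G.E} (hg : ∀ e, IsLargestBelow f e.1 (g e))
include hg

/-- The largest edge below `e` is the chosen edge of a cut through `e`. -/
theorem exists_cut_of_notMem {e : G.E} (h : e ∉ smallestEdges f) :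
    ∃ c : G.Cuts, g ⟨e, h⟩ = f c ∧ e ∈ c.1 :=
  (hf.genLE_iff.1 (hg ⟨e, h⟩).1.1).resolve_left fun heq =>
    (hg ⟨e, h⟩).1.2 (by rw [heq]; exact .refl)

theorem basisVec_mem (e : G.E) : basisVec f g e ∈ choiceMonoid f := by
  by_cases h : e ∈ smallestEdges f
  · rw [basisVec_of_mem h]
    exact vec_mem f e
  · rw [basisVec_of_notMem h]
    obtain ⟨c, hc, hec⟩ := hf.exists_cut_of_notMem hg h
    exact AddSubmonoid.subset_closure (Or.inr ⟨c, e, hec, by rw [hc]⟩)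

/-- Induction along the chains `e, g e, g (g e), …`. -/
theorem induction_largestBelow {P : G.E → Prop} (h₀ : ∀ e ∈ smallestEdges f, P e)
    (h₁ : ∀ e (h : e ∉ smallestEdges f), P (g ⟨e, h⟩) → P e) (e : G.E) : P e := by
  induction e using hf.wellFounded.induction with
  | h e ih =>
    by_cases h : e ∈ smallestEdges f
    · exact h₀ e h
    · have hlt := (hg ⟨e, h⟩).1
      exact h₁ e h (ih _ ⟨hlt.1, fun heq => hlt.2 (by rw [heq]; exact .refl)⟩)

/-- The basis vectors generate the choice monoid. -/
theorem choiceMonoid_le {N : AddSubmonoid (G.E →₀ ℤ)} (hN : ∀ e, basisVec f g e ∈ N) :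
    choiceMonoid f ≤ N := by
  refine AddSubmonoid.closure_le.2 ?_
  rintro _ (⟨e, rfl⟩ | ⟨c, e, he, rfl⟩)
  · induction e using hf.induction_largestBelow hg with
    | h₀ e h => exact basisVec_of_mem (g := g) h ▸ hN e
    | h₁ e h ih =>
      have := N.add_mem (hN e) ih
      rwa [basisVec_of_notMem h, sub_add_cancel] at this
  · -- The difference of two comparable edges is a sum of differences of consecutive ones.
    suffices ∀ b, GenLE f b e → vec e - vec b ∈ N from this _ (.of_mem c he)
    clear he
    induction e using hf.induction_largestBelow hg with
    | h₀ e h =>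
      intro b hb
      rw [hf.eq_of_genLE_smallestEdges h hb, sub_self]
      exact N.zero_mem
    | h₁ e h ih =>
      intro b hb
      by_cases hbe : b = e
      · rw [hbe, sub_self]
        exact N.zero_mem
      · have := N.add_mem (hN e)
          (ih b ((hg ⟨e, h⟩).2 b hb fun heb => hbe (hf.antisymm _ _ hb heb)))
        rwa [basisVec_of_notMem h, sub_add_sub_cancel] at this

/-- The linear map that sends an edge to the sum of the edges below it sends the basis vectors to
the standard basis. -/
theorem exists_linearMap_basisVec :
    ∃ Ψ : (G.E →₀ ℤ) →ₗ[ℤ] (G.E →₀ ℤ), ∀ e, Ψ (basisVec f g e) = Finsupp.single e 1 := by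
  classical
  have := Fintype.ofFinite G.E
  let s (e : G.E) : Finset G.E := Finset.univ.filter fun a => GenLE f a e
  let Ψ : (G.E →₀ ℤ) →ₗ[ℤ] (G.E →₀ ℤ) :=
    Finsupp.linearCombination ℤ fun e => ∑ a ∈ s e, Finsupp.single a (1 : ℤ)
  have hΨ (e : G.E) : Ψ (vec e) = ∑ a ∈ s e, Finsupp.single a (1 : ℤ) := by
    simp [Ψ, vec, Finsupp.linearCombination_single]
  refine ⟨Ψ, fun e => ?_⟩
  by_cases h : e ∈ smallestEdges f
  · have hs : s e = {e} := by
      ext a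
      simp only [s, Finset.mem_filter_univ, Finset.mem_singleton]
      exact ⟨hf.eq_of_genLE_smallestEdges h, fun h => h ▸ .refl⟩
    rw [basisVec_of_mem h, hΨ, hs, Finset.sum_singleton]
  · obtain ⟨⟨hle, hnle⟩, hmax⟩ := hg ⟨e, h⟩
    have hs : s e = insert e (s (g ⟨e, h⟩)) := by
      ext a
      simp only [s, Finset.mem_filter_univ, Finset.mem_insert]
      constructor
      · intro ha
        by_cases hae : a = e
        · exact Or.inl hae
        · exact Or.inr (hmax a ha fun hea => hae (hf.antisymm _ _ ha hea))
      · rintro (rfl | ha)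
        exacts [.refl, ha.trans hle]
    have hnot : e ∉ s (g ⟨e, h⟩) := by simpa [s] using hnle
    rw [basisVec_of_notMem h, map_sub, hΨ, hΨ, hs, Finset.sum_insert hnot, add_sub_cancel_right]

theorem exists_basis : ∃ B : Module.Basis G.E ℕ (choiceMonoid f),
    ∀ e, (B e : G.E →₀ ℤ) = basisVec f g e := by
  let v (e : G.E) : choiceMonoid f := ⟨basisVec f g e, hf.basisVec_mem hg e⟩
  have hli : LinearIndependent ℕ v := by
    obtain ⟨Ψ, hΨ⟩ := hf.exists_linearMap_basisVec hg
    refine LinearIndependent.of_comp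
      (Ψ.toAddMonoidHom.comp (choiceMonoid f).subtype).toNatLinearMap ?_
    have hsingle : LinearIndependent ℤ fun e : G.E => Finsupp.single e (1 : ℤ) :=
      Finsupp.linearIndependent_single_one ℤ G.E
    have heq : (Ψ.toAddMonoidHom.comp (choiceMonoid f).subtype).toNatLinearMap ∘ v =
        fun e => Finsupp.single e (1 : ℤ) := funext hΨ
    rw [heq]
    exact hsingle.restrict_scalars (fun a b h => by simpa using h)
  have hspan : ⊤ ≤ Submodule.span ℕ (Set.range v) := by
    rintro x -
    obtain ⟨y, hy, hyx⟩ := hf.choiceMonoid_le hg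
      (N := (Submodule.span ℕ (Set.range v)).toAddSubmonoid.map (choiceMonoid f).subtype)
      (fun e => ⟨v e, Submodule.subset_span ⟨e, rfl⟩, rfl⟩) x.2
    rwa [← Subtype.ext (a1 := y) (a2 := x) hyx]
  exact ⟨Module.Basis.mk hli hspan, fun e => by rw [Module.Basis.mk_apply]⟩

end IsOrderlyChoice

end WeaklyRich.Multigraph

namespace WeaklyRich

/-! ### Homomorphisms from free commutative monoids, and quotients by faces -/

theorem _root_.Module.Basis.monoidHom_ext {ι A M : Type*} [AddCommMonoid A] [CommMonoid M]
    (B : Module.Basis ι ℕ A) {φ ψ : Multiplicative A →* M}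
    (h : ∀ i, φ (Multiplicative.ofAdd (B i)) = ψ (Multiplicative.ofAdd (B i))) : φ = ψ := by
  have : (MonoidHom.toAdditiveRight φ).toNatLinearMap =
      (MonoidHom.toAdditiveRight ψ).toNatLinearMap := B.ext h
  ext x
  exact LinearMap.congr_fun this x

theorem _root_.Module.Basis.exists_monoidHom {ι A M : Type*} [AddCommMonoid A] [CommMonoid M]
    (B : Module.Basis ι ℕ A) (q : ι → M) :
    ∃ φ : Multiplicative A →* M, ∀ i, φ (Multiplicative.ofAdd (B i)) = q i := by
  refine ⟨AddMonoidHom.toMultiplicativeLeft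
    (B.constr ℕ fun i => Additive.ofMul (q i)).toAddMonoidHom, fun i => ?_⟩
  exact B.constr_basis ℕ (fun i => Additive.ofMul (q i)) i

/-- If a homomorphism `θ` kills the submonoid `F` and maps the basis vectors outside `F` to a basis
of the target, then it identifies the target with the quotient by `F`. -/
theorem exists_quotientCon_addEquiv {ι A C : Type*} [AddCommMonoid A] [AddCommMonoid C]
    (B : Module.Basis ι ℕ A) (F : AddSubmonoid A) (B' : Module.Basis {i // B i ∉ F} ℕ C)
    (θ : A →+ C) (h₀ : ∀ x ∈ F, θ x = 0) (h₁ : ∀ i : {i // B i ∉ F}, θ (B i.1) = B' i) :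
    ∃ φ : (quotientCon F).Quotient ≃+ C, ∀ x : A, φ (x : (quotientCon F).Quotient) = θ x := by
  classical
  have hle : quotientCon F ≤ AddCon.ker θ := by
    rintro x y ⟨a, ha, b, hb, h⟩
    have := congrArg θ h
    simpa [h₀ a ha, h₀ b hb] using this
  -- The coordinates of `θ x` are the coordinates of `x` outside `F`.
  have hcoord (x : A) (i : {i // B i ∉ F}) : B'.repr (θ x) i = B.repr x i.1 := by
    have : (B'.coord i).comp θ.toNatLinearMap = B.coord i.1 := by
      refine B.ext fun j => ?_
      by_cases hj : B j ∈ F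
      · have hne : j ≠ i.1 := fun h => i.2 (h ▸ hj)
        simp [h₀ _ hj, hne]
      · simp [h₁ ⟨j, hj⟩, Finsupp.single_apply, Subtype.ext_iff]
    exact LinearMap.congr_fun this x
  have hF (l : ι →₀ ℕ) : B.repr.symm (l.filter fun i => B i ∈ F) ∈ F := by
    rw [Module.Basis.repr_symm_apply, Finsupp.linearCombination_apply]
    refine F.sum_mem fun i hi => F.nsmul_mem ?_ _
    by_contra hn
    exact Finsupp.mem_support_iff.1 hi (Finsupp.filter_apply_neg _ _ hn)
  refine ⟨AddEquiv.ofBijective (AddCon.lift (quotientCon F) θ hle) ⟨?_, ?_⟩, fun x => rfl⟩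
  · intro x y
    induction x using AddCon.induction_on with | _ x => ?_
    induction y using AddCon.induction_on with | _ y => ?_
    intro hxy
    have hxy' : θ x = θ y := hxy
    refine (AddCon.eq _).2 ⟨B.repr.symm ((B.repr y).filter fun i => B i ∈ F), hF _,
      B.repr.symm ((B.repr x).filter fun i => B i ∈ F), hF _, B.repr.injective ?_⟩
    ext i
    by_cases hi : B i ∈ F
    · simp [hi, add_comm]
    · have := hcoord x ⟨i, hi⟩
      rw [hxy', hcoord y ⟨i, hi⟩] at this
      simp [hi, this]
  · intro y
    have hy : y ∈ Submodule.span ℕ (Set.range B') := B'.mem_span y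
    have hle' : Submodule.span ℕ (Set.range B') ≤ LinearMap.range θ.toNatLinearMap := by
      rw [Submodule.span_le]
      rintro _ ⟨i, rfl⟩
      exact ⟨B i.1, h₁ i⟩
    obtain ⟨x, hx⟩ := hle' hy
    exact ⟨(x : (quotientCon F).Quotient), hx⟩

variable {k : Type u} [Field k]

/-! ### Log structures -/

theorem LogStructure.isUnit_iff (L : LogStructure k) {m : L.M} : IsUnit m ↔ L.α m ≠ 0 := by
  refine ⟨fun h => (h.map L.α).ne_zero, fun h => ?_⟩
  obtain ⟨m', hm', -⟩ := L.units (Units.mk0 _ h)⁻¹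
  refine IsUnit.of_mul_eq_one m' ?_
  obtain ⟨n, -, hn⟩ := L.units 1
  rw [hn (m * m') (by simp [hm', h]), hn 1 (by simp)]

theorem LogStructure.eq_of_α_eq (L : LogStructure k) {m n : L.M} (h : L.α m = L.α n)
    (hn : L.α n ≠ 0) : m = n := by
  obtain ⟨r, -, hr⟩ := L.units (Units.mk0 _ hn)
  rw [hr m h, hr n rfl]

/-- In an integral log structure, divisibility is a partial order on the characteristic monoid. -/
theorem LogStructure.IsFS.dvd_antisymm {L : LogStructure k} (hL : L.IsFS) {a b : L.Char}
    (hab : a ∣ b) (hba : b ∣ a) : a = b := by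
  induction a using Quotient.inductionOn with | _ a => ?_
  induction b using Quotient.inductionOn with | _ b => ?_
  obtain ⟨c, rfl⟩ := Associates.mk_dvd_mk.1 hab
  obtain ⟨d, hd⟩ := Associates.mk_dvd_mk.1 hba
  have hu : c * d = 1 := (hL.integral a _ _ (by rw [mul_one, ← mul_assoc]; exact hd)).symm
  exact Associates.mk_eq_mk_iff_associated.2 ⟨(IsUnit.of_mul_eq_one d hu).unit, rfl⟩

theorem LogStructure.associates_mk_eq_one (L : LogStructure k) {m : L.M} (h : L.α m ≠ 0) :
    Associates.mk m = 1 :=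
  Associates.mk_eq_one.2 (L.isUnit_iff.2 h)

section Standard

variable {E : Type u}

/-- The generator of `ℕ^E ⊕ kˣ` that belongs to an element of `E`. -/
noncomputable def standardGen (k : Type u) [Field k] (e : E) : (standardLogStructure k E).M :=
  (Multiplicative.ofAdd (Finsupp.single e 1), (1 : kˣ))

/-- The inclusion of `kˣ` into `ℕ^E ⊕ kˣ`. -/
noncomputable def standardUnits (k : Type u) [Field k] (E : Type u) :
    kˣ →* (standardLogStructure k E).M :=
  MonoidHom.inr (Multiplicative (E →₀ ℕ)) kˣ

theorem standard_α_gen (e : E) : (standardLogStructure k E).α (standardGen k e) = 0 :=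
  if_neg (by simp [standardGen])

theorem standard_α_of_eq_zero {n : Multiplicative (E →₀ ℕ)} (hn : n.toAdd = 0) (a : kˣ) :
    (standardLogStructure k E).α (n, a) = a :=
  if_pos hn

theorem standard_α_units (a : kˣ) :
    (standardLogStructure k E).α (standardUnits k E a) = a :=
  standard_α_of_eq_zero toAdd_one a

theorem standard_monoidHom_ext {M : Type*} [CommMonoid M]
    {φ ψ : (standardLogStructure k E).M →* M}
    (h₁ : ∀ e, φ (standardGen k e) = ψ (standardGen k e))
    (h₂ : ∀ a, φ (standardUnits k E a) = ψ (standardUnits k E a)) : φ = ψ := by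
  let φ' : Multiplicative (E →₀ ℕ) × kˣ →* M := φ
  let ψ' : Multiplicative (E →₀ ℕ) × kˣ →* M := ψ
  suffices φ' = ψ' from this
  refine MonoidHom.coprod_unique φ' |>.symm.trans ?_ |>.trans (MonoidHom.coprod_unique ψ')
  congr 1
  · refine (Finsupp.basisSingleOne (R := ℕ) (ι := E)).monoidHom_ext fun e => ?_
    rw [Finsupp.coe_basisSingleOne]
    exact h₁ e
  · ext a
    exact h₂ a

theorem standard_exists_monoidHom {M : Type*} [CommMonoid M] (q : E → M) (r : kˣ →* M) :
    ∃ φ : (standardLogStructure k E).M →* M,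
      (∀ e, φ (standardGen k e) = q e) ∧ ∀ a, φ (standardUnits k E a) = r a := by
  obtain ⟨φ, hφ⟩ := (Finsupp.basisSingleOne (R := ℕ) (ι := E)).exists_monoidHom q
  refine ⟨(φ.coprod r : Multiplicative (E →₀ ℕ) × kˣ →* M), fun e => ?_, fun a => ?_⟩
  · have := hφ e
    simp only [Finsupp.coe_basisSingleOne] at this
    exact (congrArg₂ (· * ·) this r.map_one).trans (mul_one _)
  · exact (congrArg (· * r a) φ.map_one).trans (one_mul _)

theorem standard_isFS [Finite E] : (standardLogStructure k E).IsFS where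
  integral := by
    intro a b c h
    exact mul_left_cancel (G := Multiplicative (E →₀ ℕ) × kˣ) h
  saturated := by
    rintro ⟨a, s⟩ ⟨b, t⟩ n hn ⟨⟨c, r⟩, h⟩
    have h1 : a ^ n = b ^ n * c := congrArg Prod.fst h
    have hle : Multiplicative.toAdd b ≤ Multiplicative.toAdd a := by
      intro e
      have h2 : n * Multiplicative.toAdd a e = n * Multiplicative.toAdd b e +
          Multiplicative.toAdd c e := by
        have := DFunLike.congr_fun (congrArg Multiplicative.toAdd h1) e
        simpa using this
      exact Nat.le_of_mul_le_mul_left (by omega) (Nat.pos_of_ne_zero hn)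
    refine ⟨(Multiplicative.ofAdd (Multiplicative.toAdd a - Multiplicative.toAdd b), t⁻¹ * s), ?_⟩
    refine Prod.ext ?_ ?_
    · exact (congrArg Multiplicative.ofAdd (add_tsub_cancel_of_le hle)).symm
    · exact (mul_inv_cancel_left t s).symm
  fg := by
    have hfin : AddMonoid.FG (E →₀ ℕ) := Module.Finite.iff_addMonoid_fg.1 inferInstance
    let ι : Multiplicative (E →₀ ℕ) →* (standardLogStructure k E).Char :=
      (Associates.mkMonoidHom (M := Multiplicative (E →₀ ℕ) × kˣ)).comp (MonoidHom.inl _ _)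
    refine Monoid.fg_of_surjective ι fun x => ?_
    induction x using Quotient.inductionOn with | _ x => ?_
    exact ⟨x.1, Associates.mk_eq_mk_iff_associated.2
      ⟨Units.map (MonoidHom.inr (Multiplicative (E →₀ ℕ)) kˣ) (toUnits x.2),
        Prod.ext (mul_one x.1) (one_mul x.2)⟩⟩

/-- The characteristic monoid of a log structure that is isomorphic to a standard one is free. -/
theorem exists_basis_char {L : LogStructure k} (Φ : (standardLogStructure k E).M ≃* L.M) :
    ∃ B : Module.Basis E ℕ (Additive L.Char), ∀ e,
      B e = Additive.ofMul (Associates.mk (Φ (standardGen k e))) := by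
  let θ : (E →₀ ℕ) →+ Additive L.Char := MonoidHom.toAdditiveRight
    ((Associates.mkMonoidHom.comp Φ.toMonoidHom).comp
      (MonoidHom.inl (Multiplicative (E →₀ ℕ)) kˣ))
  have hθ (n : E →₀ ℕ) : θ n =
    Additive.ofMul (Associates.mk (Φ (Multiplicative.ofAdd n, (1 : kˣ)))) := rfl
  have hbij : Function.Bijective θ := by
    constructor
    · intro m n h
      rw [hθ, hθ] at h
      obtain ⟨v, hv⟩ := Associates.mk_eq_mk_iff_associated.1 (Additive.ofMul.injective h)
      let w := Units.map Φ.symm.toMonoidHom v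
      let x : (standardLogStructure k E).M := (Multiplicative.ofAdd m, (1 : kˣ))
      have hw : x * w.1 = (Multiplicative.ofAdd n, (1 : kˣ)) := by
        apply Φ.injective
        rw [map_mul]
        exact (congrArg (Φ x * ·) (Φ.apply_symm_apply v.1)).trans hv
      have hw1 : IsUnit (show Multiplicative (E →₀ ℕ) × kˣ from w.1).1 :=
        w.isUnit.map (MonoidHom.fst (Multiplicative (E →₀ ℕ)) kˣ)
      have hw0 : (show Multiplicative (E →₀ ℕ) × kˣ from w.1).1 = 1 := by
        have := (isUnit_iff_eq_one).1 hw1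
        exact this
      have := congrArg (Prod.fst : Multiplicative (E →₀ ℕ) × kˣ → _) hw
      have h' : Multiplicative.ofAdd m * (show Multiplicative (E →₀ ℕ) × kˣ from w.1).1 =
        Multiplicative.ofAdd n := this
      rw [hw0, mul_one] at h'
      exact Multiplicative.ofAdd.injective h'
    · intro x
      obtain ⟨m, hm⟩ := Quotient.exists_rep (Additive.toMul x)
      obtain ⟨⟨n, a⟩, rfl⟩ := Φ.surjective m
      refine ⟨Multiplicative.toAdd n, ?_⟩
      rw [hθ, ← ofMul_toMul x, ← hm]
      congr 1
      let w : (Multiplicative (E →₀ ℕ) × kˣ)ˣ :=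
        Units.map (MonoidHom.inr (Multiplicative (E →₀ ℕ)) kˣ) (toUnits a)
      refine Associates.mk_eq_mk_iff_associated.2 ⟨Units.map Φ.toMonoidHom w, ?_⟩
      refine (map_mul Φ _ _).symm.trans (congrArg Φ ?_)
      exact Prod.ext (mul_one n) (one_mul a)
  refine ⟨Module.Basis.ofRepr (AddEquiv.ofBijective θ hbij).toNatLinearEquiv.symm, fun e => ?_⟩
  rfl

end Standard

end WeaklyRich

/-! ### Log curves and their choice monoids -/

namespace WeaklyRich

namespace LogCurve

variable {k : Type u} [Field k] {X : PrestableCurve k} {z : LogCurve X}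

theorem α_smoothing (z : LogCurve X) (e : X.dualGraph.E) : z.base.α (z.smoothing e) = 0 :=
  (z.str.comm _).trans (standard_α_gen e)

theorem α_str_units (z : LogCurve X) (a : kˣ) : z.base.α (z.str.toHom (standardUnits k _ a)) = a :=
  (z.str.comm _).trans (standard_α_units a)

/-- In a weakly `1`-rich log curve, every cut has an edge of smallest length. -/
theorem IsWeaklyRich.exists_smallest (hz : z.IsWeaklyRich 1) (c : X.dualGraph.Cuts) :
    ∃ e ∈ c.1, ∀ e' ∈ c.1, z.length e ∣ z.length e' := by
  obtain ⟨_, ⟨e, he, rfl⟩, h⟩ := hz c.1 c.2 (fun _ => 1) (fun _ _ => dvd_rfl)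
  exact ⟨e, he, fun e' he' => by simpa using h _ ⟨e', he', rfl⟩⟩

theorem isWeaklyRich_one_of_exists_smallest (h : ∀ c : X.dualGraph.Cuts, ∃ e ∈ c.1, ∀ e' ∈ c.1,
    z.length e ∣ z.length e') : z.IsWeaklyRich 1 := by
  intro c hc lam hlam
  have hone (a) (ha : a ∈ z.length '' c) : lam a = 1 := Nat.dvd_one.1 (hlam a ha)
  obtain ⟨e, he, hle⟩ := h ⟨c, hc⟩
  refine ⟨z.length e, ⟨e, he, rfl⟩, ?_⟩
  rintro _ ⟨e', he', rfl⟩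
  rw [hone _ ⟨e, he, rfl⟩, hone _ ⟨e', he', rfl⟩, pow_one, pow_one]
  exact hle e' he'

theorem existsUnique_isShortestChoice (hz : z.IsWeaklyRich 1) [LinearOrder X.dualGraph.E] :
    ∃! f : X.dualGraph.Cuts → X.dualGraph.E, z.IsShortestChoice f := by
  have := X.finite_edges
  have hex (c : X.dualGraph.Cuts) : ∃ e ∈ c.1, ∀ e' ∈ c.1,
      z.length e ∣ z.length e' ∧ (z.length e' = z.length e → e ≤ e') := by
    obtain ⟨e, ⟨he, hle⟩, hmin⟩ := (wellFounded_lt (α := X.dualGraph.E)).has_min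
      {e | e ∈ c.1 ∧ ∀ e' ∈ c.1, z.length e ∣ z.length e'} (hz.exists_smallest c)
    refine ⟨e, he, fun e' he' => ⟨hle e' he', fun heq => not_lt.1 (hmin e' ⟨he', ?_⟩)⟩⟩
    rwa [heq]
  choose f hf using hex
  refine ⟨f, hf, fun f' hf' => funext fun c => ?_⟩
  have heq : z.length (f c) = z.length (f' c) := z.isFS.dvd_antisymm
    ((hf c).2 _ (hf' c).1).1 ((hf' c).2 _ (hf c).1).1
  exact le_antisymm (((hf' c).2 _ (hf c).1).2 heq) (((hf c).2 _ (hf' c).1).2 heq.symm)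

/-- The generated preorder is contained in the lexicographic combination of the order of the
lengths and the enumeration. -/
theorem IsShortestChoice.length_dvd [LinearOrder X.dualGraph.E]
    {f : X.dualGraph.Cuts → X.dualGraph.E} (hf : z.IsShortestChoice f) {a b : X.dualGraph.E}
    (h : GenLE f a b) : z.length a ∣ z.length b ∧ (z.length b = z.length a → a ≤ b) := by
  induction h with
  | refl => exact ⟨dvd_rfl, fun _ => le_rfl⟩
  | tail _ hbd ih =>
    obtain ⟨c, rfl, hd⟩ := hbd
    obtain ⟨h1, h2⟩ := (hf c).2 _ hd
    refine ⟨ih.1.trans h1, fun heq => ?_⟩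
    have h3 := z.isFS.dvd_antisymm (heq ▸ h1) ih.1
    exact (ih.2 h3).trans (h2 (heq.trans h3.symm))

theorem IsShortestChoice.isOrderlyChoice [LinearOrder X.dualGraph.E]
    {f : X.dualGraph.Cuts → X.dualGraph.E} (hf : z.IsShortestChoice f) : IsOrderlyChoice f where
  uniqueEnds := X.uniqueEnds_dualGraph
  isConnected := X.isConnected_dualGraph
  mem c := (hf c).1
  antisymm a b hab hba := by
    have heq := z.isFS.dvd_antisymm (hf.length_dvd hab).1 (hf.length_dvd hba).1
    exact le_antisymm ((hf.length_dvd hab).2 heq.symm) ((hf.length_dvd hba).2 heq)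

theorem isFace_kernel {f : X.dualGraph.Cuts → X.dualGraph.E}
    (β : Multiplicative (choiceMonoid f) →* z.base.M) : IsFace (z.kernel β) := by
  intro x y h
  have h' : z.base.α (β (Multiplicative.ofAdd x * Multiplicative.ofAdd y)) ≠ 0 := h
  rw [map_mul, map_mul] at h'
  exact ⟨left_ne_zero_of_mul h', right_ne_zero_of_mul h'⟩

variable {f : X.dualGraph.Cuts → X.dualGraph.E} {g : {e // e ∉ smallestEdges f} → X.dualGraph.E}
  {B : Module.Basis X.dualGraph.E ℕ (choiceMonoid f)}

/-- An edge, as an element of the choice monoid written multiplicatively. -/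
noncomputable def edge (f : X.dualGraph.Cuts → X.dualGraph.E) (e : X.dualGraph.E) :
    Multiplicative (choiceMonoid f) := Multiplicative.ofAdd ⟨vec e, vec_mem f e⟩

theorem ofAdd_basis_of_mem (hB : ∀ e, (B e : X.dualGraph.E →₀ ℤ) = basisVec f g e)
    {e : X.dualGraph.E} (h : e ∈ smallestEdges f) :
    Multiplicative.ofAdd (B e) = edge f e :=
  congrArg Multiplicative.ofAdd (Subtype.ext ((hB e).trans (basisVec_of_mem h)))

theorem edge_mul_ofAdd_basis (hB : ∀ e, (B e : X.dualGraph.E →₀ ℤ) = basisVec f g e)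
    {e : X.dualGraph.E} (h : e ∉ smallestEdges f) :
    edge f (g ⟨e, h⟩) * Multiplicative.ofAdd (B e) = edge f e := by
  refine congrArg Multiplicative.ofAdd (Subtype.ext ?_)
  change vec (g ⟨e, h⟩) + (B e : X.dualGraph.E →₀ ℤ) = vec e
  rw [hB, basisVec_of_notMem h, add_sub_cancel]

/-- A homomorphism from the choice monoid to a cancellative monoid is determined by its values on
the edges. -/
theorem monoidHom_ext_of_edge (hB : ∀ e, (B e : X.dualGraph.E →₀ ℤ) = basisVec f g e)
    {M : Type*} [CommMonoid M] (hM : ∀ a b c : M, a * b = a * c → b = c)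
    {φ ψ : Multiplicative (choiceMonoid f) →* M} (h : ∀ e, φ (edge f e) = ψ (edge f e)) :
    φ = ψ := by
  refine B.monoidHom_ext fun e => ?_
  by_cases he : e ∈ smallestEdges f
  · rw [ofAdd_basis_of_mem hB he, h]
  · refine hM (φ (edge f (g ⟨e, he⟩))) _ _ ?_
    rw [← map_mul, edge_mul_ofAdd_basis hB he, h, h, ← map_mul, edge_mul_ofAdd_basis hB he]

theorem existsUnique_extends (hf : IsOrderlyChoice f)
    (hlen : ∀ c : X.dualGraph.Cuts, ∀ e ∈ c.1, z.length (f c) ∣ z.length e)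
    (hg : ∀ e, IsLargestBelow f e.1 (g e))
    (hB : ∀ e, (B e : X.dualGraph.E →₀ ℤ) = basisVec f g e) :
    ∃! β : Multiplicative (choiceMonoid f) →* z.base.M, z.Extends β := by
  have := X.finite_edges
  have hq (e : X.dualGraph.E) : ∃ q : z.base.M, (e ∈ smallestEdges f → q = z.smoothing e) ∧
      ∀ h : e ∉ smallestEdges f, z.smoothing (g ⟨e, h⟩) * q = z.smoothing e := by
    by_cases h : e ∈ smallestEdges f
    · exact ⟨z.smoothing e, fun _ => rfl, fun h' => absurd h h'⟩
    · obtain ⟨c, hc, hec⟩ := hf.exists_cut_of_notMem hg h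
      have hdvd := hlen c e hec
      rw [← hc] at hdvd
      obtain ⟨q, hq⟩ := Associates.mk_dvd_mk.1 hdvd
      exact ⟨q, fun h' => absurd h' h, fun _ => hq.symm⟩
  choose q hq₀ hq₁ using hq
  obtain ⟨β, hβ⟩ := B.exists_monoidHom q
  have hβe (e) : β (edge f e) = z.smoothing e := by
    induction e using hf.induction_largestBelow hg with
    | h₀ e h => rw [← ofAdd_basis_of_mem hB h, hβ, hq₀ e h]
    | h₁ e h ih => rw [← edge_mul_ofAdd_basis hB h, map_mul, ih, hβ, hq₁]
  exact ⟨β, hβe, fun β' hβ' =>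
    monoidHom_ext_of_edge hB z.isFS.integral fun e => (hβ' e).trans (hβe e).symm⟩

/-- The log structure `ℕ^J ⊕ kˣ` on the basis vectors `J` of the choice monoid outside the face
`F` defines a weakly `1`-rich log curve through which `z` factors, the vectors in `F` being sent to
units. Minimality splits this factorization, and the splitting is an inverse because both sides are
generated by the smoothing parameters, up to differences. -/
theorem IsMinimalWeaklyRich.exists_mulEquiv (hz : z.IsMinimalWeaklyRich 1)
    (hf : IsOrderlyChoice f)
    (hB : ∀ e, (B e : X.dualGraph.E →₀ ℤ) = basisVec f g e)
    {β : Multiplicative (choiceMonoid f) →* z.base.M} (hβ : z.Extends β) :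
    ∃ Φ : (standardLogStructure k {e // B e ∉ z.kernel β}).M ≃* z.base.M,
      ∀ e, Φ (standardGen k e) =
        β (Multiplicative.ofAdd (B e.1)) := by
  classical
  have := X.finite_edges
  let J := {e // B e ∉ z.kernel β}
  let N := standardLogStructure k J
  have hβα (x : Multiplicative (choiceMonoid f)) :
      x.toAdd ∈ z.kernel β ↔ z.base.α (β x) ≠ 0 := Iff.rfl
  -- The quotient map from the choice monoid to the new log structure.
  obtain ⟨p, hp⟩ := B.exists_monoidHom (M := N.M) fun e =>
    if h : B e ∈ z.kernel β then standardUnits k J (Units.mk0 _ h)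
    else standardGen k ⟨e, h⟩
  have hp₀ {e} (h : B e ∈ z.kernel β) :
      p (Multiplicative.ofAdd (B e)) = standardUnits k J (Units.mk0 _ h) := (hp e).trans (dif_pos h)
  have hp₁ (e : J) : p (Multiplicative.ofAdd (B e.1)) = standardGen k e :=
    (hp e.1).trans (dif_neg e.2)
  have hpα : N.α.comp p = z.base.α.comp β := by
    refine B.monoidHom_ext fun e => ?_
    rw [MonoidHom.comp_apply, MonoidHom.comp_apply]
    by_cases h : B e ∈ z.kernel β
    · rw [hp₀ h]
      exact standard_α_units _
    · rw [hp₁ ⟨e, h⟩]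
      refine (standard_α_gen _).trans ?_
      by_contra hn
      exact h ((hβα _).2 (Ne.symm hn))
  obtain ⟨s, hs₁, hs₂⟩ := standard_exists_monoidHom (fun e => p (edge f e)) (standardUnits k J)
  obtain ⟨i, hi₁, hi₂⟩ := standard_exists_monoidHom
    (fun e : J => β (Multiplicative.ofAdd (B e.1)))
    (z.str.toHom.comp (standardUnits k X.dualGraph.E))
  have hip : i.comp p = β := by
    refine B.monoidHom_ext fun e => ?_
    rw [MonoidHom.comp_apply]
    by_cases h : B e ∈ z.kernel β
    · rw [hp₀ h]
      exact (hi₂ _).trans (z.base.eq_of_α_eq (z.α_str_units _) h)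
    · rw [hp₁ ⟨e, h⟩]
      exact hi₁ ⟨e, h⟩
  have hsα : N.α.comp s = (standardLogStructure k X.dualGraph.E).α := by
    refine standard_monoidHom_ext (fun e => ?_) fun a => ?_
    · rw [MonoidHom.comp_apply, hs₁, standard_α_gen]
      exact (DFunLike.congr_fun hpα _).trans ((congrArg z.base.α (hβ e)).trans (z.α_smoothing e))
    · rw [MonoidHom.comp_apply, hs₂, standard_α_units]
      exact (standard_α_units a).symm
  have hiα : z.base.α.comp i = N.α := by
    refine standard_monoidHom_ext (fun e => ?_) fun a => ?_
    · rw [MonoidHom.comp_apply, hi₁, standard_α_gen]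
      by_contra hn
      exact e.2 ((hβα _).2 hn)
    · rw [MonoidHom.comp_apply, hi₂, standard_α_units]
      exact z.α_str_units a
  have his : i.comp s = z.str.toHom := by
    refine standard_monoidHom_ext (fun e => ?_) fun a => ?_
    · rw [MonoidHom.comp_apply, hs₁]
      exact (DFunLike.congr_fun hip _).trans (hβ e)
    · rw [MonoidHom.comp_apply, hs₂]
      exact hi₂ a
  let w : LogCurve X := ⟨N, standard_isFS, ⟨s, DFunLike.congr_fun hsα⟩⟩
  have hw : w.IsWeaklyRich 1 := by
    refine isWeaklyRich_one_of_exists_smallest fun c => ⟨f c, hf.mem c, fun e he => ?_⟩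
    refine Associates.mk_dvd_mk.2 ?_
    let d : choiceMonoid f := ⟨vec e - vec (f c),
      AddSubmonoid.subset_closure (Or.inr ⟨c, e, he, rfl⟩)⟩
    have hd : edge f e = edge f (f c) * Multiplicative.ofAdd d :=
      congrArg Multiplicative.ofAdd (Subtype.ext (add_sub_cancel (vec (f c)) (vec e)).symm)
    have h₁ : w.smoothing e = p (edge f e) := hs₁ e
    have h₂ : w.smoothing (f c) = p (edge f (f c)) := hs₁ (f c)
    rw [h₁, h₂, hd, map_mul]
    exact Dvd.intro _ rfl
  let j : z ⟶ w := ⟨⟨i, DFunLike.congr_fun hiα⟩, DFunLike.congr_fun his⟩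
  obtain ⟨h, hh, -⟩ := hz.2 w z hw hz.1 (𝟙 z) j
  have hih (m : z.base.M) : i (h.base.toHom m) = m :=
    DFunLike.congr_fun (congrArg (fun q : z ⟶ z => q.base.toHom) hh) m
  have hhi : h.base.toHom.comp i = MonoidHom.id N.M := by
    have hcancel : ∀ a b c : N.M, a * b = a * c → b = c := w.isFS.integral
    have hunits (a : kˣ) : h.base.toHom (i (standardUnits k J a)) = standardUnits k J a := by
      have h1 : i (standardUnits k J a) = z.str.toHom (standardUnits k X.dualGraph.E a) := hi₂ a
      rw [h1, h.comm]
      exact hs₂ a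
    have hcomp : (h.base.toHom.comp i).comp p = p := by
      refine monoidHom_ext_of_edge hB hcancel fun e => ?_
      have h1 : i (p (edge f e)) = z.smoothing e := (DFunLike.congr_fun hip _).trans (hβ e)
      rw [MonoidHom.comp_apply, MonoidHom.comp_apply, h1]
      exact (h.comm _).trans (hs₁ e)
    refine standard_monoidHom_ext (fun e => ?_) hunits
    rw [← hp₁ e]
    exact DFunLike.congr_fun hcomp _
  exact ⟨MulEquiv.ofBijective i ⟨Function.LeftInverse.injective (DFunLike.congr_fun hhi),
    Function.RightInverse.surjective hih⟩, hi₁⟩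

end LogCurve

end WeaklyRich

theorem mainTheorem10 {k : Type u} [Field k] [IsAlgClosed k] (X : PrestableCurve k)
    (z : LogCurve X) (hz : z.IsMinimalWeaklyRich 1) :
    -- the characteristic monoid of the base is a finitely generated free commutative monoid
    (Module.Free ℕ (Additive z.base.Char) ∧ Module.Finite ℕ (Additive z.base.Char)) ∧
    -- and it is computed as follows, for every enumeration of the edges
    ∀ _ : LinearOrder X.dualGraph.E,
      (∃! f : X.dualGraph.Cuts → X.dualGraph.E, z.IsShortestChoice f) ∧
      ∀ f : X.dualGraph.Cuts → X.dualGraph.E, z.IsShortestChoice f →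
        -- the preorder generated by `f` is a partial order
        (∀ a b, GenLE f a b → GenLE f b a → a = b) ∧
        -- every circuit-connected component has a unique smallest edge
        (∀ t, X.dualGraph.IsCircuitComponent t → ∃! m, IsSmallestIn f t m) ∧
        -- every other edge `e` has a largest edge `g e` below it
        ∃ g : {e // e ∉ smallestEdges f} → X.dualGraph.E,
          (∀ e, IsLargestBelow f e.1 (g e)) ∧
          -- `M_f` is free on the smallest edges and the differences `e - g e`
          ∃ B : Module.Basis X.dualGraph.E ℕ (choiceMonoid f),
            (∀ e ∈ smallestEdges f, (B e : X.dualGraph.E →₀ ℤ) = vec e) ∧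
            (∀ e : {e // e ∉ smallestEdges f},
              (B e.1 : X.dualGraph.E →₀ ℤ) = vec e.1 - vec (g e)) ∧
            -- the map `ℕ^E → M` extends uniquely to `M_f`
            (∃! β : Multiplicative (choiceMonoid f) →* z.base.M, z.Extends β) ∧
            ∀ β : Multiplicative (choiceMonoid f) →* z.base.M, z.Extends β →
              -- the kernel of `M_f → k / kˣ` is a face
              IsFace (z.kernel β) ∧
              -- and the characteristic monoid is the quotient of `M_f` by this face
              (∃ φ : (quotientCon (z.kernel β)).Quotient ≃+ Additive z.base.Char,
                ∀ x : choiceMonoid f, φ (x : (quotientCon (z.kernel β)).Quotient) =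
                  Additive.ofMul (Associates.mk (β (Multiplicative.ofAdd x)))) ∧
              -- so that it is free on the classes of the generators outside the face
              ∃ B' : Module.Basis {e // B e ∉ z.kernel β} ℕ (Additive z.base.Char),
                ∀ e, B' e = Additive.ofMul (Associates.mk (β (Multiplicative.ofAdd (B e.1)))) := by
  have := X.finite_edges
  refine ⟨?_, fun _ => ⟨LogCurve.existsUnique_isShortestChoice hz.1, fun f hf => ?_⟩⟩
  · let := open Classical in linearOrderOfSTO (WellOrderingRel (α := X.dualGraph.E))
    obtain ⟨f, hf, -⟩ := LogCurve.existsUnique_isShortestChoice hz.1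
    have hf' := hf.isOrderlyChoice
    choose g hg using fun e : {e // e ∉ smallestEdges f} => hf'.exists_isLargestBelow e.2
    obtain ⟨B, hB⟩ := hf'.exists_basis hg
    obtain ⟨β, hβ, -⟩ := LogCurve.existsUnique_extends hf' (fun c e he => ((hf c).2 e he).1) hg hB
    obtain ⟨Φ, -⟩ := hz.exists_mulEquiv hf' hB hβ
    obtain ⟨B', -⟩ := exists_basis_char Φ
    exact ⟨.of_basis B', .of_basis B'⟩
  · have hf' := hf.isOrderlyChoice
    choose g hg using fun e : {e // e ∉ smallestEdges f} => hf'.exists_isLargestBelow e.2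
    obtain ⟨B, hB⟩ := hf'.exists_basis hg
    refine ⟨hf'.antisymm, fun t => hf'.existsUnique_isSmallestIn, g, hg, B,
      fun e he => (hB e).trans (basisVec_of_mem he),
      fun e => (hB e.1).trans (basisVec_of_notMem e.2),
      LogCurve.existsUnique_extends hf' (fun c e he => ((hf c).2 e he).1) hg hB,
      fun β hβ => ?_⟩
    obtain ⟨Φ, hΦ⟩ := hz.exists_mulEquiv hf' hB hβ
    obtain ⟨B', hB'⟩ := exists_basis_char Φ
    have hB'β (e) : B' e = Additive.ofMul (Associates.mk (β (Multiplicative.ofAdd (B e.1)))) := by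
      rw [hB', hΦ]
    refine ⟨LogCurve.isFace_kernel β, ?_, B', hB'β⟩
    exact exists_quotientCon_addEquiv B (z.kernel β) B'
      (MonoidHom.toAdditiveRight (Associates.mkMonoidHom.comp β))
      (fun x hx => congrArg Additive.ofMul (z.base.associates_mk_eq_one hx))
      (fun e => (hB'β e).symm)
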